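/- Let $X,Y$ be (essentially) bounded real random variables on a common probability space, with laws $\nu_X,\nu_Y$ on $\mathbb R$; $X$ and $Y$ need not be independent. Let $\{(X(i),Y(i))\}_{i\ge 1}$ be an i.i.d. family of copies of the pair $(X,Y)$ on a probability space $(\Omega,\mathbf P)$. For each positive integer $N$ let $X^{(N)}=\operatorname{diag}(X(1),\dots,X(N))$ and $Y^{(N)}=\operatorname{diag}(Y(1),\dots,Y(N))$, and let $H^{(N)}$ be a deterministic $N\times N$ complex Hadamard matrix, i.e. $|H^{(N)}(i,j)|=1$ for all $i,j$ and $H^{(N)}/\sqrt N$ is unitary. Put $Z^{(N)}=\frac1N H^{(N)}Y^{(N)}H^{(N)*}$. View $N\times N$ random matrices on $\Omega$ with essentially bounded complex entries as elements of a noncommutative probability space with the tracial state $\phi_N(A)=\frac1N\mathbf E\operatorname{tr}A$. (1) $X^{(N)}$ and $Z^{(N)}$ are asymptotically free: for every noncommutative polynomial $f\in\mathbb C\langle \mathbf X_1,\mathbf X_2\rangle$ the limit $\mu(f)=\lim_{N\to\infty}\phi_N\big(f(X^{(N)},Z^{(N)})\big)$ exists, and $\mathbf X_1,\mathbf X_2$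 are free with respect to $\mu$, i.e. $\mu(f_1\cdots f_\ell)=0$ whenever $\ell\ge2$, $f_j\in\mathbb C\langle\mathbf X_{i_j}\rangle$, $\mu(f_j)=0$ for all $j$, and $i_1\ne i_2,\ \dots,\ i_{\ell-1}\ne i_\ell$. (2) The law of $X^{(N)}+Z^{(N)}$ converges in moments to the free additive convolution $\nu_X\boxplus\nu_Y$: for every integer $k\ge0$, $$\lim_{N\to\infty}\phi_N\big((X^{(N)}+Z^{(N)})^k\big)=\int x^k\,d(\nu_X\boxplus\nu_Y)(x).$$ (3) If the entries of $X^{(N)}$ are nonnegative almost surely for all $N$, then the law of $(X^{(N)})^{1/2}Z^{(N)}(X^{(N)})^{1/2}$ converges in moments to the free multiplicative convolution $\nu_X\boxtimes\nu_Y$: for every integer $k\ge0$, $$\lim_{N\to\infty}\phi_N\Big(\big((X^{(N)})^{1/2}Z^{(N)}(X^{(N)})^{1/2}\big)^k\Big)=\int x^k\,d(\nu_X\boxtimes\nu_Y)(x).$$ Here $\nu_X\boxplus\nu_Y$ and (for $\nu_X$ carried by $[0,\infty)$) $\nu_X\boxtimes\nu_Y$ are the compactly supported probability measures on $\mathbb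 R$ whose $k$-th moments are those of $a+b$ and of $ab$, respectively, for free noncommutative random variables $a,b$ whose moments are those of $\nu_X$ and $\nu_Y$; their existence is part of the claim. -/

import Mathlib

open MeasureTheory ProbabilityTheory Filter Topology
open scoped ENNReal

/-! ### Noncommutative probability: laws, freeness, asymptotic freeness

A noncommutative probability space is a unital complex algebra `A` with a linear functional
`φ : A →ₗ[ℂ] ℂ` such that `φ 1 = 1`. The algebra of noncommutative polynomials in variables
indexed by `ι` is `FreeAlgebra ℂ ι`. -/

section FreeProbability

variable {A : Type*} [Ring A] [Algebra ℂ A] {ι : Type*}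

/-- The joint law of a family `a` with respect to `φ`: the functional `f ↦ φ (f(a))` on
noncommutative polynomials. -/
noncomputable def jointLaw (φ : A →ₗ[ℂ] ℂ) (a : ι → A) : FreeAlgebra ℂ ι →ₗ[ℂ] ℂ :=
  φ ∘ₗ (FreeAlgebra.lift ℂ a).toLinearMap

/-- A family of unital subalgebras is free with respect to `φ`: `φ` vanishes on every product of
at least two centered elements taken from subalgebras whose consecutive indices differ. The list
`L` holds the factors, each one together with its index. -/
def FreeSubalgebras (φ : A →ₗ[ℂ] ℂ) (S : ι → Subalgebra ℂ A) : Prop :=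
  ∀ L : List (ι × A), 2 ≤ L.length → L.IsChain (fun p q => p.1 ≠ q.1) →
    (∀ p ∈ L, p.2 ∈ S p.1 ∧ φ p.2 = 0) → φ (L.map Prod.snd).prod = 0

/-- A family of elements is free if the unital subalgebras they generate are free. -/
def FreeFamily (φ : A →ₗ[ℂ] ℂ) (a : ι → A) : Prop :=
  FreeSubalgebras φ fun i => Algebra.adjoin ℂ {a i}

/-- The law of the noncommutative random variable `a` is given by the measure `ν` on `ℝ`
(to be used for compactly supported `ν`): all moments agree. -/
def HasMomentsOf (φ : A →ₗ[ℂ] ℂ) (a : A) (ν : Measure ℝ) : Prop :=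
  ∀ k : ℕ, φ (a ^ k) = ((∫ x, x ^ k ∂ν : ℝ) : ℂ)

/-- The sequence of families `a N` is asymptotically free: the joint laws converge in moments to a
state on noncommutative polynomials with respect to which the variables are free. -/
def AsymptoticallyFree {B : ℕ → Type*} [∀ N, Ring (B N)] [∀ N, Algebra ℂ (B N)]
    (φ : ∀ N, B N →ₗ[ℂ] ℂ) (a : ∀ N, ι → B N) : Prop :=
  ∃ μ : FreeAlgebra ℂ ι →ₗ[ℂ] ℂ, μ 1 = 1 ∧
    (∀ f, Tendsto (fun N => jointLaw (φ N) (a N) f) atTop (𝓝 (μ f))) ∧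
    FreeFamily μ (FreeAlgebra.ι ℂ)

/-- The laws of the noncommutative random variables `a N` converge in moments to `ν`. -/
def ConvergesInMoments {B : ℕ → Type*} [∀ N, Ring (B N)] [∀ N, Algebra ℂ (B N)]
    (φ : ∀ N, B N →ₗ[ℂ] ℂ) (a : ∀ N, B N) (ν : Measure ℝ) : Prop :=
  ∀ k : ℕ, Tendsto (fun N => φ N (a N ^ k)) atTop (𝓝 ((∫ x, x ^ k ∂ν : ℝ) : ℂ))

end FreeProbability

/-! ### Free convolutions of compactly supported probability measures -/

/-- `ρ` is a compactly supported probability measure giving the law of `p`, where `p` is a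
noncommutative polynomial in two free variables whose laws are `μ` and `ν`. (Any free pair in any
noncommutative probability space with these laws has the same joint law as such a pair of
variables, and `ρ` is unique, since it is determined by its moments.) -/
structure IsFreePolynomialLaw (p : FreeAlgebra ℂ (Fin 2)) (μ ν ρ : Measure ℝ) : Prop where
  isProbabilityMeasure : IsProbabilityMeasure ρ
  compactSupport : ∃ K : Set ℝ, IsCompact K ∧ ρ Kᶜ = 0
  moments : ∃ τ : FreeAlgebra ℂ (Fin 2) →ₗ[ℂ] ℂ, τ 1 = 1 ∧
    FreeFamily τ (FreeAlgebra.ι ℂ) ∧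
    HasMomentsOf τ (FreeAlgebra.ι ℂ 0) μ ∧ HasMomentsOf τ (FreeAlgebra.ι ℂ 1) ν ∧
    HasMomentsOf τ p ρ

/-- `ρ` is the free additive convolution of `μ` and `ν`: the law of `a + b` for `a`, `b` free with
laws `μ`, `ν`. -/
def IsFreeAdditiveConvolution (μ ν ρ : Measure ℝ) : Prop :=
  IsFreePolynomialLaw (FreeAlgebra.ι ℂ 0 + FreeAlgebra.ι ℂ 1) μ ν ρ

/-- `ρ` is the free multiplicative convolution of `μ` and `ν` (`μ` carried by `[0, ∞)`): the measure
whose moments are those of `a * b` (equivalently of `a^{1/2} b a^{1/2}`) for `a`, `b` free with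
laws `μ`, `ν`. -/
def IsFreeMultiplicativeConvolution (μ ν ρ : Measure ℝ) : Prop :=
  IsFreePolynomialLaw (FreeAlgebra.ι ℂ 0 * FreeAlgebra.ι ℂ 1) μ ν ρ

open Classical in
/-- The free additive convolution `μ ⊞ ν` (`0` if there is none). -/
noncomputable def freeAdditiveConvolution (μ ν : Measure ℝ) : Measure ℝ :=
  if h : ∃ ρ, IsFreeAdditiveConvolution μ ν ρ then h.choose else 0

open Classical in
/-- The free multiplicative convolution `μ ⊠ ν` (`0` if there is none). -/
noncomputable def freeMultiplicativeConvolution (μ ν : Measure ℝ) : Measure ℝ :=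
  if h : ∃ ρ, IsFreeMultiplicativeConvolution μ ν ρ then h.choose else 0

/-! ### Random matrices with essentially bounded entries -/

section RandomMatrices

variable {Ω : Type*} [MeasurableSpace Ω]

/-- The algebra of `N × N` random matrices on `(Ω, P)` with essentially bounded complex entries. -/
def RandomMatrix (P : Measure Ω) (N : ℕ) : Subalgebra ℂ (Ω → Matrix (Fin N) (Fin N) ℂ) where
  carrier := {M | ∀ i j, MemLp (fun ω => M ω i j) ∞ P}
  mul_mem' := by
    intro M M' hM hM' i j
    simp only [Pi.mul_apply, Matrix.mul_apply]
    exact memLp_finsetSum _ fun k _ => (hM' k j).mul (hM i k)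
  add_mem' := fun hM hM' i j => (hM i j).add (hM' i j)
  algebraMap_mem' := fun c i j =>
    memLp_top_const (algebraMap ℂ (Matrix (Fin N) (Fin N) ℂ) c i j)

/-- The functional `M ↦ (1/N) 𝔼 tr M`; a tracial state when `N > 0`. -/
noncomputable def expectedTrace (P : Measure Ω) [IsProbabilityMeasure P] (N : ℕ) :
    RandomMatrix P N →ₗ[ℂ] ℂ where
  toFun M := (N : ℂ)⁻¹ * ∫ ω, (M.1 ω).trace ∂P
  map_add' := by
    intro M M'
    have h : ∀ M : RandomMatrix P N, Integrable (fun ω => (M.1 ω).trace) P := fun M =>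
      integrable_finsetSum _ fun i _ => (M.2 i i).integrable (by simp)
    rw [← mul_add, ← integral_add (h M) (h M')]
    simp [Matrix.trace_add]
  map_smul' := by
    intro c M
    simp only [Subalgebra.coe_smul, Pi.smul_apply, Matrix.trace_smul, smul_eq_mul,
      RingHom.id_apply, integral_const_mul]
    ring

/-- A deterministic matrix as a random matrix. -/
def constMatrix (P : Measure Ω) {N : ℕ} (H : Matrix (Fin N) (Fin N) ℂ) : RandomMatrix P N :=
  ⟨fun _ => H, fun i j => memLp_top_const (H i j)⟩

/-- The `N × N` random diagonal matrix with diagonal entries `Z 0, …, Z (N - 1)`. -/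
def diagMatrix {P : Measure Ω} (N : ℕ) {Z : ℕ → Ω → ℝ} (hZ : ∀ i, MemLp (Z i) ∞ P) :
    RandomMatrix P N :=
  ⟨fun ω => Matrix.diagonal fun i : Fin N => ((Z i ω : ℝ) : ℂ), by
    intro i j
    by_cases h : i = j
    · subst h
      simpa using (hZ i).ofReal (K := ℂ)
    · simp [Matrix.diagonal_apply_ne _ h]⟩

theorem memLp_top_sqrt {P : Measure Ω} {Z : Ω → ℝ} (hZ : MemLp Z ∞ P) :
    MemLp (fun ω => Real.sqrt (Z ω)) ∞ P := by
  refine (hZ.norm.add (memLp_top_const (1 : ℝ))).of_le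
    (Real.continuous_sqrt.comp_aestronglyMeasurable hZ.1) (Eventually.of_forall fun ω => ?_)
  have h0 : (0 : ℝ) ≤ ‖Z ω‖ := norm_nonneg _
  have h1 : Z ω ≤ ‖Z ω‖ := Real.le_norm_self _
  simp only [Pi.add_apply]
  rw [Real.norm_of_nonneg (Real.sqrt_nonneg _), Real.norm_of_nonneg (by linarith)]
  exact Real.sqrt_le_iff.2 ⟨by linarith, by nlinarith⟩

/-- `(Xs i, Ys i)`, `i = 0, 1, …`, is an i.i.d. family of copies of the pair `(X, Y)`. -/
structure IsIIDCopies {Ω₀ : Type*} [MeasurableSpace Ω₀] (P₀ : Measure Ω₀) (X Y : Ω₀ → ℝ)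
    (P : Measure Ω) (Xs Ys : ℕ → Ω → ℝ) : Prop where
  identDistrib : ∀ i, IdentDistrib (fun ω => (Xs i ω, Ys i ω)) (fun ω => (X ω, Y ω)) P P₀
  indep : iIndepFun (fun i ω => (Xs i ω, Ys i ω)) P

section

variable {Ω₀ : Type*} [MeasurableSpace Ω₀] {P₀ : Measure Ω₀} {X Y : Ω₀ → ℝ}
  {P : Measure Ω} {Xs Ys : ℕ → Ω → ℝ}

theorem IsIIDCopies.memLp_fst (h : IsIIDCopies P₀ X Y P Xs Ys) (hX : MemLp X ∞ P₀) (i : ℕ) :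
    MemLp (Xs i) ∞ P :=
  ((h.identDistrib i).comp measurable_fst).memLp_iff.2 hX

theorem IsIIDCopies.memLp_snd (h : IsIIDCopies P₀ X Y P Xs Ys) (hY : MemLp Y ∞ P₀) (i : ℕ) :
    MemLp (Ys i) ∞ P :=
  ((h.identDistrib i).comp measurable_snd).memLp_iff.2 hY

end

/-- The random matrix `(1/N) H M H^*` for a deterministic matrix `H`. -/
noncomputable def conjBy {P : Measure Ω} {N : ℕ} (H : Matrix (Fin N) (Fin N) ℂ)
    (M : RandomMatrix P N) : RandomMatrix P N :=
  (N : ℂ)⁻¹ • (constMatrix P H * M * constMatrix P H.conjTranspose)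

end RandomMatrices

/-! Call a product of polynomials in single variables centered if consecutive variables differ and
each factor has mean zero. Such words, with the empty one, span all noncommutative polynomials
(`span_centeredWords`). Hence a normalized functional that vanishes on the nonempty ones is unique,
is free, and has the prescribed marginals; asymptotic freeness reduces to showing that the expected
trace of every nonempty centered word tends to `0`.

For even length `2 * m`, write each factor as `U * D * star U` with `D` diagonal and `U` either `1`
or `H / √N`. Between neighbouring diagonals, and cyclically between the last and the first, stands
`H / √N` or its adjoint, with entries of size `N ^ (-1/2)`. The trace is then a sum over index words
`s : Fin (2 * m) → Fin N` with coefficients of size at most `N ^ (-m)`. Independence over `i` and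
centering kill every `s` in which some index occurs exactly once, and only `O(N ^ m)` words remain.
The unnormalized trace is `O(1)`, the normalized one `O(1/N)`. Dependence between `X` and `Y` is
harmless: a lone index meets only one factor.

For odd length at least three, the two ends involve the same variable. Traciality merges them;
centering the merged letter leaves an even word and a shorter odd word. Length one is exactly zero.

The convolutions exist because the limiting moments come from uniformly bounded Hermitian matrices:
the limit is nonnegative on polynomials nonnegative on `[-C, C]`, so M. Riesz extension and the
Riesz–Markov theorem give a measure. Uniqueness of the free functional identifies its moments. For
the product, `S * Z * S` and `S * S * Z` have powers of equal trace. -/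

/-! ### Alternating centered words and freeness -/

section CenteredWords

variable {A B : Type*} [Ring A] [Algebra ℂ A] [Ring B] [Algebra ℂ B] {ι : Type*}

/-- The product of the polynomials `p` in the elements `a i`, for the letters `(i, p)` of `L`. -/
noncomputable def wordEval (a : ι → A) (L : List (ι × Polynomial ℂ)) : A :=
  (L.map fun p => Polynomial.aeval (a p.1) p.2).prod

/-- Consecutive letters have different indices, and every letter is centered with respect to the
functional `c i` that belongs to its index. -/
def IsCenteredWord (c : ι → Polynomial ℂ →ₗ[ℂ] ℂ) (L : List (ι × Polynomial ℂ)) : Prop :=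
  L.IsChain (fun p q => p.1 ≠ q.1) ∧ ∀ p ∈ L, c p.1 p.2 = 0

@[simp] theorem wordEval_nil (a : ι → A) : wordEval a [] = 1 := rfl

@[simp] theorem wordEval_cons (a : ι → A) (p : ι × Polynomial ℂ) (L : List (ι × Polynomial ℂ)) :
    wordEval a (p :: L) = Polynomial.aeval (a p.1) p.2 * wordEval a L := rfl

theorem wordEval_append (a : ι → A) (L L' : List (ι × Polynomial ℂ)) :
    wordEval a (L ++ L') = wordEval a L * wordEval a L' := by
  simp [wordEval]

theorem map_wordEval (g : A →ₐ[ℂ] B) (a : ι → A) (L : List (ι × Polynomial ℂ)) :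
    g (wordEval a L) = wordEval (fun i => g (a i)) L := by
  induction L with
  | nil => simp
  | cons p L ih => simp [ih, Polynomial.aeval_algHom_apply]

theorem jointLaw_wordEval (φ : A →ₗ[ℂ] ℂ) (a : ι → A) (L : List (ι × Polynomial ℂ)) :
    jointLaw φ a (wordEval (FreeAlgebra.ι ℂ) L) = φ (wordEval a L) := by
  simp [jointLaw, map_wordEval]

variable {c : ι → Polynomial ℂ →ₗ[ℂ] ℂ}

theorem isCenteredWord_cons {p : ι × Polynomial ℂ} {L : List (ι × Polynomial ℂ)} :
    IsCenteredWord c (p :: L) ↔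
      (∀ q ∈ L.head?, p.1 ≠ q.1) ∧ c p.1 p.2 = 0 ∧ IsCenteredWord c L := by
  simp only [IsCenteredWord, List.isChain_cons, List.mem_cons, forall_eq_or_imp]
  tauto

theorem apply_sub_C (hc : ∀ i, c i 1 = 1) (i : ι) (p : Polynomial ℂ) :
    c i (p - Polynomial.C (c i p)) = 0 := by
  have : Polynomial.C (c i p) = c i p • (1 : Polynomial ℂ) := by
    rw [Polynomial.smul_eq_C_mul, mul_one]
  rw [this, map_sub, map_smul, hc, smul_eq_mul, mul_one, sub_self]

/-- The span contains `1` and is stable under left multiplication by each generator, hence is a left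
ideal containing `1`. -/
theorem span_centeredWords (hc : ∀ i, c i 1 = 1) :
    Submodule.span ℂ {x | ∃ L, IsCenteredWord c L ∧ wordEval (FreeAlgebra.ι ℂ) L = x} =
      (⊤ : Submodule ℂ (FreeAlgebra ℂ ι)) := by
  set S := Submodule.span ℂ {x | ∃ L, IsCenteredWord c L ∧ wordEval (FreeAlgebra.ι ℂ) L = x}
  have word : ∀ L, IsCenteredWord c L → wordEval (FreeAlgebra.ι ℂ) L ∈ S := fun L hL =>
    Submodule.subset_span ⟨L, hL, rfl⟩
  -- Split `p` into its centered part and its mean: the first prolongs the word, the second gives a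
  -- multiple of it.
  have step : ∀ (i : ι) (p : Polynomial ℂ) L, IsCenteredWord c L → (∀ q ∈ L.head?, i ≠ q.1) →
      Polynomial.aeval (FreeAlgebra.ι ℂ i) p * wordEval (FreeAlgebra.ι ℂ) L ∈ S := by
    intro i p L hL hi
    have h1 := word ((i, p - Polynomial.C (c i p)) :: L)
      (isCenteredWord_cons.2 ⟨hi, apply_sub_C hc i p, hL⟩)
    have h2 := S.add_mem h1 (S.smul_mem (c i p) (word L hL))
    convert h2 using 1
    simp [sub_mul, Algebra.smul_def]
  have mul : ∀ (i : ι) L, IsCenteredWord c L →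
      FreeAlgebra.ι ℂ i * wordEval (FreeAlgebra.ι ℂ) L ∈ S := by
    intro i L hL
    by_cases h : ∀ q ∈ L.head?, i ≠ q.1
    · simpa using step i Polynomial.X L hL h
    -- The head already has index `i`, so the generator is absorbed into the head polynomial.
    · cases L with
      | nil => simp at h
      | cons q L =>
        simp only [List.head?_cons, Option.mem_def, Option.some.injEq, forall_eq', not_not] at h
        have hq := isCenteredWord_cons.1 hL
        have := step i (Polynomial.X * q.2) L hq.2.2 (h ▸ hq.1)
        simpa [h, mul_assoc] using this
  have key : ∀ x : FreeAlgebra ℂ ι, ∀ y ∈ S, x * y ∈ S := by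
    intro x
    induction x using FreeAlgebra.induction with
    | grade0 r => intro y hy; rw [← Algebra.smul_def]; exact S.smul_mem r hy
    | grade1 i =>
      intro y hy
      induction hy using Submodule.span_induction with
      | mem y hy => obtain ⟨L, hL, rfl⟩ := hy; exact mul i L hL
      | zero => simp
      | add y z _ _ h1 h2 => rw [mul_add]; exact S.add_mem h1 h2
      | smul r y _ h => rw [mul_smul_comm]; exact S.smul_mem r h
    | mul a b ha hb => intro y hy; rw [mul_assoc]; exact ha _ (hb y hy)
    | add a b ha hb => intro y hy; rw [add_mul]; exact S.add_mem (ha y hy) (hb y hy)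
  rw [eq_top_iff]
  intro x _
  simpa using key x 1 (word [] ⟨List.isChain_nil, by simp⟩)

theorem eq_of_forall_centeredWord (hc : ∀ i, c i 1 = 1) {μ τ : FreeAlgebra ℂ ι →ₗ[ℂ] ℂ}
    (hμ1 : μ 1 = 1) (hτ1 : τ 1 = 1)
    (hμ : ∀ L ≠ [], IsCenteredWord c L → μ (wordEval (FreeAlgebra.ι ℂ) L) = 0)
    (hτ : ∀ L ≠ [], IsCenteredWord c L → τ (wordEval (FreeAlgebra.ι ℂ) L) = 0) : μ = τ := by
  refine LinearMap.ext_on (span_centeredWords hc) ?_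
  rintro _ ⟨L, hL, rfl⟩
  by_cases h : L = []
  · simp [h, hμ1, hτ1]
  · rw [hμ L h hL, hτ L h hL]

theorem apply_aeval_of_forall_centeredWord (hc : ∀ i, c i 1 = 1) {μ : FreeAlgebra ℂ ι →ₗ[ℂ] ℂ}
    (hμ1 : μ 1 = 1)
    (hμ : ∀ L ≠ [], IsCenteredWord c L → μ (wordEval (FreeAlgebra.ι ℂ) L) = 0) (i : ι)
    (p : Polynomial ℂ) : μ (Polynomial.aeval (FreeAlgebra.ι ℂ i) p) = c i p := by
  have h := hμ [(i, p - Polynomial.C (c i p))] (by simp)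
    (isCenteredWord_cons.2 ⟨by simp, apply_sub_C hc i p, List.isChain_nil, by simp⟩)
  rw [wordEval_cons, wordEval_nil, mul_one, map_sub, map_sub, Polynomial.aeval_C,
    Algebra.algebraMap_eq_smul_one, map_smul, hμ1, sub_eq_zero] at h
  simpa using h

/-- An element of the algebra generated by one variable is a polynomial in it, and one-letter words
show that centering for `μ` is centering for `c`. -/
theorem freeFamily_of_forall_centeredWord (hc : ∀ i, c i 1 = 1) {μ : FreeAlgebra ℂ ι →ₗ[ℂ] ℂ}
    (hμ1 : μ 1 = 1)
    (hμ : ∀ L ≠ [], IsCenteredWord c L → μ (wordEval (FreeAlgebra.ι ℂ) L) = 0) :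
    FreeFamily μ (FreeAlgebra.ι ℂ) := by
  intro L hlen hchain hL
  have h : ∀ q : ι × FreeAlgebra ℂ ι, ∃ p : Polynomial ℂ,
      q ∈ L → Polynomial.aeval (FreeAlgebra.ι ℂ q.1) p = q.2 := by
    intro q
    by_cases hq : q ∈ L
    · have : q.2 ∈ Algebra.adjoin ℂ {FreeAlgebra.ι ℂ q.1} := (hL q hq).1
      rw [Algebra.adjoin_singleton_eq_range_aeval] at this
      obtain ⟨p, hp⟩ := this
      exact ⟨p, fun _ => hp⟩
    · exact ⟨0, fun h => absurd h hq⟩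
  choose p hp using h
  have hmap : L.map Prod.snd =
      (L.map fun q => (q.1, p q)).map fun p => Polynomial.aeval (FreeAlgebra.ι ℂ p.1) p.2 := by
    rw [List.map_map]
    exact List.map_congr_left fun q hq => (hp q hq).symm
  rw [hmap]
  refine hμ _ (fun h => ?_) ⟨?_, ?_⟩
  · rw [List.map_eq_nil_iff.1 h] at hlen
    simp at hlen
  · rw [List.isChain_map]
    exact hchain
  · intro r hr
    obtain ⟨q, hq, rfl⟩ := List.mem_map.1 hr
    rw [← apply_aeval_of_forall_centeredWord hc hμ1 hμ]
    simp only [hp q hq]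
    exact (hL q hq).2

/-- Freeness only concerns products of at least two factors; words of length one need the marginals
`hc`. -/
theorem FreeFamily.apply_centeredWord {τ : FreeAlgebra ℂ ι →ₗ[ℂ] ℂ}
    (hτ : FreeFamily τ (FreeAlgebra.ι ℂ))
    (hc : ∀ i p, τ (Polynomial.aeval (FreeAlgebra.ι ℂ i) p) = c i p) :
    ∀ L ≠ [], IsCenteredWord c L → τ (wordEval (FreeAlgebra.ι ℂ) L) = 0 := by
  intro L hne hL
  match L, hne, hL with
  | [q], _, hL => simp [hc, hL.2 q (by simp)]
  | q :: r :: L, _, hL =>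
    set L' := (q :: r :: L).map
      fun p => (p.1, Polynomial.aeval (FreeAlgebra.ι ℂ p.1) p.2) with hL'
    have := hτ L' (by simp [hL']) (by rw [hL', List.isChain_map]; exact hL.1) (by
      intro t ht
      obtain ⟨s, hs, rfl⟩ := List.mem_map.1 ht
      refine ⟨Polynomial.aeval_mem_adjoin_singleton _ _, ?_⟩
      rw [hc]
      exact hL.2 s hs)
    rw [hL', List.map_map] at this
    exact this

/-- Having a limit is stable under linear combinations, so the spanning words suffice; linearity
then passes to the limit. -/
theorem exists_limit_of_forall_centeredWord {B : ℕ → Type*} [∀ N, Ring (B N)]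
    [∀ N, Algebra ℂ (B N)] {φ : ∀ N, B N →ₗ[ℂ] ℂ} {a : ∀ N, ι → B N} (hc : ∀ i, c i 1 = 1)
    (h1 : Tendsto (fun N => φ N 1) atTop (𝓝 1))
    (h : ∀ L ≠ [], IsCenteredWord c L →
      Tendsto (fun N => φ N (wordEval (a N) L)) atTop (𝓝 0)) :
    ∃ μ : FreeAlgebra ℂ ι →ₗ[ℂ] ℂ, μ 1 = 1 ∧
      (∀ f, Tendsto (fun N => jointLaw (φ N) (a N) f) atTop (𝓝 (μ f))) ∧
      ∀ L ≠ [], IsCenteredWord c L → μ (wordEval (FreeAlgebra.ι ℂ) L) = 0 := by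
  have hex : ∀ f : FreeAlgebra ℂ ι, ∃ l : ℂ,
      Tendsto (fun N => jointLaw (φ N) (a N) f) atTop (𝓝 l) := by
    intro f
    have hf : f ∈ Submodule.span ℂ
        {x | ∃ L, IsCenteredWord c L ∧ wordEval (FreeAlgebra.ι ℂ) L = x} := by
      rw [span_centeredWords hc]; trivial
    induction hf using Submodule.span_induction with
    | mem y hy =>
      obtain ⟨L, hL, rfl⟩ := hy
      simp only [jointLaw_wordEval]
      by_cases hne : L = []
      · exact ⟨1, by simpa [hne] using h1⟩
      · exact ⟨0, h L hne hL⟩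
    | zero => exact ⟨0, by simp⟩
    | add y z _ _ h1 h2 =>
      obtain ⟨l, hl⟩ := h1
      obtain ⟨m, hm⟩ := h2
      exact ⟨l + m, by simpa using hl.add hm⟩
    | smul r y _ h =>
      obtain ⟨l, hl⟩ := h
      exact ⟨r * l, by simpa using hl.const_mul r⟩
  choose m hm using hex
  refine ⟨⟨⟨m, fun x y => ?_⟩, fun r x => ?_⟩, ?_, hm, ?_⟩
  · exact tendsto_nhds_unique (hm (x + y)) (by simpa using (hm x).add (hm y))
  · exact tendsto_nhds_unique (hm (r • x)) (by simpa using (hm x).const_mul r)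
  · exact tendsto_nhds_unique (hm 1) (by simpa [jointLaw] using h1)
  · intro L hne hL
    refine tendsto_nhds_unique (hm (wordEval (FreeAlgebra.ι ℂ) L)) ?_
    simpa only [jointLaw_wordEval] using h L hne hL

end CenteredWords

/-! ### Expansion of traces over index words -/

section TraceExpansion

variable {N : ℕ}

/-- The bound is on the sum over the row index because, for a nonempty product, the leading diagonal
forces `i = s 0`. Summing over `i` therefore costs no factor `N`, and the induction closes. -/
theorem exists_entry_expansion {n : ℕ} (V : Fin n → Matrix (Fin N) (Fin N) ℂ) {b : ℝ}
    (hb : 0 ≤ b) (hV : ∀ q i j, ‖V q i j‖ ≤ b) :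
    ∃ c : Fin N → Fin N → (Fin n → Fin N) → ℂ, (∀ j s, ∑ i, ‖c i j s‖ ≤ b ^ n) ∧
      ∀ (f : Fin n → Fin N → ℂ) (i j : Fin N),
        (List.ofFn fun q => Matrix.diagonal (f q) * V q).prod i j =
          ∑ s, c i j s * ∏ q, f q (s q) := by
  induction n with
  | zero =>
    refine ⟨fun i j _ => (1 : Matrix (Fin N) (Fin N) ℂ) i j, fun j s => ?_, fun f i j => by simp⟩
    rw [Finset.sum_eq_single j (fun i _ h => by simp [h]) (by simp)]
    simp
  | succ n ih =>
    obtain ⟨c, hc, h⟩ := ih (fun q => V q.succ) (fun q => hV q.succ)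
    refine ⟨fun i j s => if i = s 0 then ∑ l, V 0 i l * c l j (fun q => s q.succ) else 0,
      fun j s => ?_, fun f i j => ?_⟩
    · rw [Finset.sum_eq_single (s 0) (fun i _ h => by simp [h]) (by simp)]
      simp only [if_true]
      calc ‖∑ l, V 0 (s 0) l * c l j (fun q => s q.succ)‖
          ≤ ∑ l, b * ‖c l j (fun q => s q.succ)‖ := by
            refine norm_sum_le_of_le _ fun l _ => ?_
            rw [norm_mul]
            exact mul_le_mul_of_nonneg_right (hV 0 _ _) (norm_nonneg _)
        _ ≤ b * b ^ n := by
            rw [← Finset.mul_sum]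
            exact mul_le_mul_of_nonneg_left (hc _ _) hb
        _ = b ^ (n + 1) := by ring
    · rw [List.ofFn_succ, List.prod_cons, Matrix.mul_apply,
        ← (Fin.consEquiv fun _ => Fin N).sum_comp, Fintype.sum_prod_type]
      simp only [Matrix.diagonal_mul, h, Fin.consEquiv, Equiv.coe_fn_mk, Fin.cons_zero,
        Fin.cons_succ, Fin.prod_univ_succ, Finset.mul_sum]
      rw [Finset.sum_comm]
      conv_rhs => rw [Finset.sum_eq_single i (fun k _ hk => by simp [hk.symm]) (by simp)]
      simp only [if_true, Finset.sum_mul]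
      refine Finset.sum_congr rfl fun s _ => Finset.sum_congr rfl fun l _ => ?_
      ring

/-- The outer diagonal also fixes the closing index as `s 0`. The empty product is excluded since
its trace is `N`. -/
theorem exists_trace_expansion {n : ℕ} (hn : n ≠ 0) (V : Fin n → Matrix (Fin N) (Fin N) ℂ) {b : ℝ}
    (hb : 0 ≤ b) (hV : ∀ q i j, ‖V q i j‖ ≤ b) :
    ∃ c : (Fin n → Fin N) → ℂ, (∀ s, ‖c s‖ ≤ b ^ n) ∧
      ∀ f : Fin n → Fin N → ℂ, (List.ofFn fun q => Matrix.diagonal (f q) * V q).prod.trace =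
        ∑ s, c s * ∏ q, f q (s q) := by
  obtain ⟨n, rfl⟩ := Nat.exists_eq_succ_of_ne_zero hn
  obtain ⟨c, hc, h⟩ := exists_entry_expansion (fun q : Fin n => V q.succ) hb (fun q => hV q.succ)
  refine ⟨fun s => ∑ l, V 0 (s 0) l * c l (s 0) (fun q => s q.succ), fun s => ?_, fun f => ?_⟩
  · calc ‖∑ l, V 0 (s 0) l * c l (s 0) (fun q => s q.succ)‖
        ≤ ∑ l, b * ‖c l (s 0) (fun q => s q.succ)‖ := by
          refine norm_sum_le_of_le _ fun l _ => ?_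
          rw [norm_mul]
          exact mul_le_mul_of_nonneg_right (hV 0 _ _) (norm_nonneg _)
      _ ≤ b * b ^ n := by
          rw [← Finset.mul_sum]
          exact mul_le_mul_of_nonneg_left (hc _ _) hb
      _ = b ^ (n + 1) := by ring
  · rw [List.ofFn_succ, List.prod_cons, Matrix.trace,
      ← (Fin.consEquiv fun _ => Fin N).sum_comp, Fintype.sum_prod_type]
    refine Finset.sum_congr rfl fun i _ => ?_
    rw [Matrix.diag_apply, Matrix.mul_apply]
    simp only [Matrix.diagonal_mul, h, Fin.consEquiv, Equiv.coe_fn_mk, Fin.cons_zero,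
      Fin.cons_succ, Fin.prod_univ_succ, Finset.mul_sum, Finset.sum_mul]
    rw [Finset.sum_comm]
    refine Finset.sum_congr rfl fun s _ => Finset.sum_congr rfl fun l _ => ?_
    ring

end TraceExpansion

/-! ### Counting index words without singletons -/

open Classical in
/-- There are at most `O(N ^ m)` words of length `2 * m` over `N` letters in which no letter occurs
exactly once. -/
theorem card_no_singleton_le {m N : ℕ} (hN : 0 < N) :
    (Finset.univ.filter fun s : Fin (2 * m) → Fin N => ∀ q, ∃ q' ≠ q, s q' = s q).card ≤
      m ^ (2 * m) * N ^ m := by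
  have hcard : m ^ (2 * m) * N ^ m =
      (Finset.univ : Finset ((Fin (2 * m) → Fin m) × (Fin m → Fin N))).card := by
    simp
  rw [hcard]
  -- Each letter used occurs at least twice, so at most `m` letters are used and the word factors
  -- through `Fin m`; factorizations are counted instead of words.
  refine Finset.card_le_card_of_surjOn (fun p => p.2 ∘ p.1) fun s hs => ?_
  simp only [Finset.coe_filter, Finset.mem_univ, true_and, Set.mem_ofPred_eq] at hs
  have hT : 2 * (Finset.univ.image s).card ≤ (Finset.univ : Finset (Fin (2 * m))).card := by
    refine Finset.mul_card_image_le_card _ _ fun b hb => ?_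
    obtain ⟨q, -, rfl⟩ := Finset.mem_image.1 hb
    obtain ⟨q', hne, hq'⟩ := hs q
    exact Finset.one_lt_card.2 ⟨q, by simp, q', by simp [hq'], hne.symm⟩
  have hT' : Fintype.card (Finset.univ.image s) ≤ Fintype.card (Fin m) := by
    simp only [Finset.card_univ, Fintype.card_fin, Fintype.card_coe] at hT ⊢
    omega
  obtain ⟨e⟩ := Function.Embedding.nonempty_of_card_le hT'
  refine ⟨(fun q => e ⟨s q, by simp⟩, Function.extend e Subtype.val fun _ => ⟨0, hN⟩), by simp, ?_⟩
  ext q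
  simp [e.injective.extend_apply]

/-! ### Expectations with independent centered entries -/

section IndependentEntries

variable {Ω E : Type*} [MeasurableSpace Ω] [MeasurableSpace E] {P : Measure Ω}
  {ν : Measure E} {Z : ℕ → Ω → E} {n : ℕ} {g : Fin n → E → ℂ} {B : ℝ}

theorem ae_norm_prod_le (hZ : ∀ i, AEMeasurable (Z i) P) (hlaw : ∀ i, P.map (Z i) = ν)
    (hB : ∀ q, ∀ᵐ z ∂ν, ‖g q z‖ ≤ B) (s : Fin n → ℕ) :
    ∀ᵐ ω ∂P, ‖∏ q, g q (Z (s q) ω)‖ ≤ B ^ n := by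
  have h : ∀ᵐ ω ∂P, ∀ q, ‖g q (Z (s q) ω)‖ ≤ B :=
    ae_all_iff.2 fun q => ae_of_ae_map (hZ (s q)) (by rw [hlaw]; exact hB q)
  filter_upwards [h] with ω hω
  rw [norm_prod]
  exact (Finset.prod_le_prod (fun _ _ => norm_nonneg _) fun q _ => hω q).trans (by simp)

theorem aestronglyMeasurable_prod (hZ : ∀ i, AEMeasurable (Z i) P) (hg : ∀ q, Measurable (g q))
    (s : Fin n → ℕ) : AEStronglyMeasurable (fun ω => ∏ q, g q (Z (s q) ω)) P :=
  Finset.aestronglyMeasurable_fun_prod _ fun q _ =>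
    ((hg q).comp_aemeasurable (hZ (s q))).aestronglyMeasurable

/-- Grouping the factors by the value of `s` makes the groups independent; the group at `s q₀` is
the single centered factor `g q₀`. -/
theorem integral_prod_eq_zero_of_singleton (hind : iIndepFun Z P)
    (hZ : ∀ i, AEMeasurable (Z i) P) (hlaw : ∀ i, P.map (Z i) = ν) (hg : ∀ q, Measurable (g q))
    (h0 : ∀ q, ∫ z, g q z ∂ν = 0) {N : ℕ} (s : Fin n → Fin N) (q₀ : Fin n)
    (hq₀ : ∀ q, q ≠ q₀ → s q ≠ s q₀) : ∫ ω, ∏ q, g q (Z (s q) ω) ∂P = 0 := by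
  have hfib : ∀ ω, ∏ q, g q (Z (s q) ω) =
      ∏ v : Fin N, (fun z => ∏ q with s q = v, g q z) (Z v ω) := by
    intro ω
    rw [← Finset.prod_fiberwise Finset.univ s]
    refine Finset.prod_congr rfl fun v _ => Finset.prod_congr rfl fun q hq => ?_
    rw [(Finset.mem_filter.1 hq).2]
  simp_rw [hfib]
  rw [(hind.precomp Fin.val_injective).integral_fun_prod_comp
    (f := fun (v : Fin N) z => ∏ q with s q = v, g q z) (fun v => hZ v)
    fun v => (Finset.measurable_prod _ fun q _ => hg q).aestronglyMeasurable]
  refine Finset.prod_eq_zero (Finset.mem_univ (s q₀)) ?_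
  have hsing : (Finset.univ.filter fun q => s q = s q₀) = {q₀} := by
    ext q
    simp only [Finset.mem_filter, Finset.mem_univ, true_and, Finset.mem_singleton]
    exact ⟨fun h => by_contra fun hne => hq₀ q hne h, fun h => h ▸ rfl⟩
  simp only [hsing, Finset.prod_singleton]
  rw [← integral_map (hZ _) (hg q₀).aestronglyMeasurable, hlaw, h0]

/-- A trace of a product of an even number of random diagonal matrices with independent centered
entries, separated by deterministic matrices with entries of size `N ^ (-1/2)`, is bounded in
expectation. -/
theorem norm_integral_trace_le (hind : iIndepFun Z P)
    (hZ : ∀ i, AEMeasurable (Z i) P) (hlaw : ∀ i, P.map (Z i) = ν) {m : ℕ} (hm : m ≠ 0)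
    {g : Fin (2 * m) → E → ℂ} (hg : ∀ q, Measurable (g q))
    (hB : ∀ q, ∀ᵐ z ∂ν, ‖g q z‖ ≤ B) (h0 : ∀ q, ∫ z, g q z ∂ν = 0) {N : ℕ} (hN : 0 < N)
    (V : Fin (2 * m) → Matrix (Fin N) (Fin N) ℂ) (hV : ∀ q i j, ‖V q i j‖ ≤ (√(N : ℝ))⁻¹) :
    ‖∫ ω, (List.ofFn fun q =>
      Matrix.diagonal (fun i : Fin N => g q (Z i ω)) * V q).prod.trace ∂P‖ ≤
      m ^ (2 * m) * B ^ (2 * m) := by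
  classical
  have := hind.isProbabilityMeasure
  obtain ⟨c, hc, h⟩ := exists_trace_expansion (by omega) V (by positivity) hV
  simp_rw [h]
  have hint : ∀ s : Fin (2 * m) → Fin N, Integrable (fun ω => ∏ q, g q (Z (s q) ω)) P := fun s =>
    Integrable.of_bound (aestronglyMeasurable_prod hZ hg fun q => s q) _
      (ae_norm_prod_le hZ hlaw hB fun q => s q)
  have hbd : ∀ s : Fin (2 * m) → Fin N, ‖∫ ω, ∏ q, g q (Z (s q) ω) ∂P‖ ≤ B ^ (2 * m) := fun s => by
    simpa using norm_integral_le_of_norm_le_const (ae_norm_prod_le hZ hlaw hB fun q => s q)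
  -- No sign is assumed for `B`; evenness of the exponent supplies it.
  have hB0 : 0 ≤ B ^ (2 * m) := by rw [pow_mul]; positivity
  rw [integral_finsetSum _ fun s _ => (hint s).const_mul _]
  simp_rw [integral_const_mul]
  rw [← Finset.sum_filter_of_ne
    (p := fun s : Fin (2 * m) → Fin N => ∀ q, ∃ q' ≠ q, s q' = s q)]
  -- The coefficient size `N ^ (-m)` exactly cancels the number `N ^ m` of surviving words.
  · have hNm : ((√(N : ℝ))⁻¹) ^ (2 * m) * (N : ℝ) ^ m = 1 := by
      rw [pow_mul, inv_pow, Real.sq_sqrt (by positivity), ← mul_pow,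
        inv_mul_cancel₀ (by positivity), one_pow]
    calc _ ≤ ∑ s : Fin (2 * m) → Fin N with (∀ q, ∃ q' ≠ q, s q' = s q),
            ((√(N : ℝ))⁻¹) ^ (2 * m) * B ^ (2 * m) := by
          refine norm_sum_le_of_le _ fun s _ => ?_
          rw [norm_mul]
          exact mul_le_mul (hc s) (hbd s) (norm_nonneg _) (by positivity)
      _ ≤ (m ^ (2 * m) * N ^ m : ℕ) * (((√(N : ℝ))⁻¹) ^ (2 * m) * B ^ (2 * m)) := by
          rw [Finset.sum_const, nsmul_eq_mul]
          refine mul_le_mul_of_nonneg_right ?_ (by positivity)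
          exact_mod_cast card_no_singleton_le hN
      _ = (((√(N : ℝ))⁻¹) ^ (2 * m) * (N : ℝ) ^ m) * (m ^ (2 * m) * B ^ (2 * m)) := by
          push_cast; ring
      _ = _ := by rw [hNm, one_mul]
  · intro s _ hs
    by_contra hcon
    push Not at hcon
    obtain ⟨q₀, hq₀⟩ := hcon
    exact hs (by rw [integral_prod_eq_zero_of_singleton hind hZ hlaw hg h0 s q₀ hq₀, mul_zero])

end IndependentEntries

/-! ### Polynomials in bounded random variables -/

theorem exists_ae_norm_eval_le {Ω : Type*} [MeasurableSpace Ω] {P : Measure Ω} {W : Ω → ℝ}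
    (hW : MemLp W ∞ P) (p : Polynomial ℂ) : ∃ B : ℝ, ∀ᵐ ω ∂P, ‖p.eval (W ω : ℂ)‖ ≤ B := by
  have hcont : Continuous fun x : ℝ => p.eval (x : ℂ) :=
    p.continuous.comp Complex.continuous_ofReal
  obtain ⟨B, hB⟩ :=
    (isCompact_closedBall (0 : ℝ) (eLpNorm W ∞ P).toReal).exists_bound_of_continuousOn
      hcont.continuousOn
  refine ⟨B, ?_⟩
  filter_upwards [ae_le_eLpNormEssSup (f := W) (μ := P)] with ω hω
  refine hB _ ?_
  rw [mem_closedBall_zero_iff, eLpNorm_exponent_top]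
  have := ENNReal.toReal_mono (by simpa using hW.2.ne) hω
  simpa using this

theorem integrable_eval {Ω : Type*} [MeasurableSpace Ω] {P : Measure Ω} [IsFiniteMeasure P]
    {W : Ω → ℝ} (hW : MemLp W ∞ P) (p : Polynomial ℂ) :
    Integrable (fun ω => p.eval (W ω : ℂ)) P := by
  obtain ⟨B, hB⟩ := exists_ae_norm_eval_le hW p
  exact Integrable.of_bound ((p.continuous.comp Complex.continuous_ofReal).comp_aestronglyMeasurable
    hW.1) B hB

/-- The functional `p ↦ 𝔼 p(W)` on polynomials, for a bounded random variable `W`. -/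
noncomputable def evalMean {Ω : Type*} [MeasurableSpace Ω] {P : Measure Ω} [IsFiniteMeasure P]
    {W : Ω → ℝ} (hW : MemLp W ∞ P) : Polynomial ℂ →ₗ[ℂ] ℂ where
  toFun p := ∫ ω, p.eval (W ω : ℂ) ∂P
  map_add' p q := by
    simp only [Polynomial.eval_add]
    exact integral_add (integrable_eval hW p) (integrable_eval hW q)
  map_smul' r p := by
    simp [integral_const_mul]

theorem evalMean_apply {Ω : Type*} [MeasurableSpace Ω] {P : Measure Ω} [IsFiniteMeasure P]
    {W : Ω → ℝ} (hW : MemLp W ∞ P) (p : Polynomial ℂ) :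
    evalMean hW p = ∫ ω, p.eval (W ω : ℂ) ∂P := rfl

/-! ### Unitary conjugation and Hadamard matrices -/

/-- Regroups a product of conjugates so that the connecting matrices `U' q * U (q + 1)` appear; if
`U n = U 0`, both sides then have equal trace for unitary `U 0`. -/
theorem List.prod_ofFn_mul_telescope {M : Type*} [Monoid M] {n : ℕ} (U U' : ℕ → M)
    (F : Fin n → M) :
    (List.ofFn fun q : Fin n => U q * F q * U' q).prod * U n =
      U 0 * (List.ofFn fun q : Fin n => F q * (U' q * U (q + 1))).prod := by
  induction n generalizing U U' with
  | zero => simp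
  | succ n ih =>
    have := ih (fun q => U (q + 1)) (fun q => U' (q + 1)) (fun q => F q.succ)
    simp only [List.ofFn_succ, List.prod_cons, Fin.val_zero, Fin.val_succ] at this ⊢
    rw [mul_assoc, this]
    simp [mul_assoc]

theorem aeval_unitary_conj_diagonal {N : ℕ} (u : unitary (Matrix (Fin N) (Fin N) ℂ))
    (d : Fin N → ℂ) (p : Polynomial ℂ) :
    Polynomial.aeval
      ((u : Matrix (Fin N) (Fin N) ℂ) * Matrix.diagonal d * star (u : Matrix _ _ ℂ)) p =
      (u : Matrix (Fin N) (Fin N) ℂ) * Matrix.diagonal (fun i => p.eval (d i)) *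
        star (u : Matrix _ _ ℂ) := by
  have h1 : (u : Matrix (Fin N) (Fin N) ℂ) * Matrix.diagonal d * star (u : Matrix _ _ ℂ) =
      (Unitary.conjStarAlgAut ℂ _ u).toAlgEquiv.toAlgHom (Matrix.diagonalAlgHom ℂ d) := rfl
  have h2 : (fun i => p.eval (d i)) = Polynomial.aeval d p := by
    rw [Polynomial.aeval_pi_apply]
    rfl
  rw [h1, Polynomial.aeval_algHom_apply, Polynomial.aeval_algHom_apply, h2]
  rfl

theorem trace_unitary_conj {N : ℕ} (u : unitary (Matrix (Fin N) (Fin N) ℂ))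
    (M : Matrix (Fin N) (Fin N) ℂ) :
    ((u : Matrix (Fin N) (Fin N) ℂ) * M * star (u : Matrix _ _ ℂ)).trace = M.trace := by
  rw [Matrix.trace_mul_comm, ← mul_assoc, Unitary.coe_star_mul_self, one_mul]

theorem trace_eq_of_mul_unitary_eq {N : ℕ} (u : unitary (Matrix (Fin N) (Fin N) ℂ))
    {A B : Matrix (Fin N) (Fin N) ℂ}
    (h : A * (u : Matrix (Fin N) (Fin N) ℂ) = (u : Matrix (Fin N) (Fin N) ℂ) * B) :
    A.trace = B.trace := by
  rw [← trace_unitary_conj u B, ← h, mul_assoc, Unitary.mul_star_self_of_mem u.2, mul_one]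

theorem expectedTrace_mul_comm {Ω : Type*} [MeasurableSpace Ω] {P : Measure Ω}
    [IsProbabilityMeasure P] {N : ℕ} (A B : RandomMatrix P N) :
    expectedTrace P N (A * B) = expectedTrace P N (B * A) := by
  have : ∀ ω, ((A * B).1 ω).trace = ((B * A).1 ω).trace := fun ω => Matrix.trace_mul_comm _ _
  simp only [expectedTrace, LinearMap.coe_mk, AddHom.coe_mk, this]

theorem expectedTrace_one {Ω : Type*} [MeasurableSpace Ω] {P : Measure Ω}
    [IsProbabilityMeasure P] {N : ℕ} (hN : 0 < N) : expectedTrace P N 1 = 1 := by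
  have : (N : ℂ) ≠ 0 := by exact_mod_cast hN.ne'
  simp [expectedTrace, this]

theorem wordEval_apply {Ω : Type*} [MeasurableSpace Ω] {P : Measure Ω} {N : ℕ} {ι : Type*}
    (a : ι → RandomMatrix P N) (L : List (ι × Polynomial ℂ)) (ω : Ω) :
    (wordEval a L).1 ω = wordEval (fun i => (a i).1 ω) L :=
  map_wordEval ((Pi.evalAlgHom ℂ (fun _ : Ω => Matrix (Fin N) (Fin N) ℂ) ω).comp
    (RandomMatrix P N).val) a L

/-- The unitary matrices `1` and `H / √N`. -/
noncomputable def hadamardFrame {N : ℕ} (hN : 0 < N) {H : Matrix (Fin N) (Fin N) ℂ}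
    (hH : H.IsHadamard) : Fin 2 → unitary (Matrix (Fin N) (Fin N) ℂ) :=
  ![1, ⟨((√(N : ℝ))⁻¹ : ℂ) • H, by
    have h : ((√(N : ℝ))⁻¹ : ℂ) * ((√(N : ℝ))⁻¹ : ℂ) * N = 1 := by
      rw [← mul_inv, ← Complex.ofReal_mul, Real.mul_self_sqrt (by positivity),
        Complex.ofReal_natCast, inv_mul_cancel₀ (by exact_mod_cast hN.ne')]
    have h1 := hH.mul_conjTranspose
    have h2 := hH.conjTranspose_mul
    simp only [Fintype.card_fin] at h1 h2
    rw [Unitary.mem_iff]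
    rw [mul_assoc] at h
    constructor <;> simp [Matrix.star_eq_conjTranspose, smul_smul, h1, h2, h]⟩]

theorem norm_hadamardFrame_le {N : ℕ} (hN : 0 < N) {H : Matrix (Fin N) (Fin N) ℂ}
    (hH : H.IsHadamard) {k l : Fin 2} (hkl : k ≠ l) (i j : Fin N) :
    ‖(star (hadamardFrame hN hH k : Matrix (Fin N) (Fin N) ℂ) *
      (hadamardFrame hN hH l : Matrix (Fin N) (Fin N) ℂ)) i j‖ ≤ (√(N : ℝ))⁻¹ := by
  have h : ∀ i j, ‖H i j‖ = 1 := fun i j =>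
    CStarRing.norm_of_mem_unitary (hH.apply_mem i j)
  fin_cases k <;> fin_cases l <;>
    simp_all [hadamardFrame, Matrix.star_eq_conjTranspose, abs_of_nonneg, Real.sqrt_nonneg]

/-- The two coordinates of a pair of real numbers, as a family indexed by `Fin 2`. -/
def pairCoord : Fin 2 → ℝ × ℝ → ℝ := ![Prod.fst, Prod.snd]

theorem measurable_pairCoord (i : Fin 2) : Measurable (pairCoord i) := by
  fin_cases i
  · exact measurable_fst
  · exact measurable_snd

theorem two_mul_nsmul_one_fin_two (m : ℕ) : (2 * m) • (1 : Fin 2) = 0 := by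
  rw [mul_nsmul, show 2 • (1 : Fin 2) = 0 by decide, nsmul_zero]

theorem IsCenteredWord.getElem_fst {c : Fin 2 → Polynomial ℂ →ₗ[ℂ] ℂ}
    {L : List (Fin 2 × Polynomial ℂ)} (hL : IsCenteredWord c L) (h0 : 0 < L.length) (q : ℕ)
    (hq : q < L.length) : L[q].1 = L[0].1 + q • (1 : Fin 2) := by
  induction q with
  | zero => simp
  | succ q ih =>
    have h1 := List.isChain_iff_getElem.1 hL.1 q hq
    rw [ih (by omega)] at h1
    rw [succ_nsmul]
    have key : ∀ x y z : Fin 2, x + y ≠ z → z = x + (y + 1) := by decide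
    exact key _ _ _ h1

/-! ### Centered words in the matrix model -/

section Model

variable {Ω₀ Ω : Type*} [MeasurableSpace Ω₀] [MeasurableSpace Ω] {P₀ : Measure Ω₀} {P : Measure Ω}
  {X Y : Ω₀ → ℝ} {Xs Ys : ℕ → Ω → ℝ}

theorem modelPair_apply (hXs : ∀ i, MemLp (Xs i) ∞ P) (hYs : ∀ i, MemLp (Ys i) ∞ P) {N : ℕ}
    (hN : 0 < N) {H : Matrix (Fin N) (Fin N) ℂ} (hH : H.IsHadamard) (k : Fin 2) (ω : Ω) :
    ((![diagMatrix N hXs, conjBy H (diagMatrix N hYs)] : Fin 2 → RandomMatrix P N) k).1 ω =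
      (hadamardFrame hN hH k : Matrix (Fin N) (Fin N) ℂ) *
        Matrix.diagonal (fun i : Fin N => (pairCoord k (Xs i ω, Ys i ω) : ℂ)) *
        star (hadamardFrame hN hH k : Matrix (Fin N) (Fin N) ℂ) := by
  fin_cases k
  · simp [hadamardFrame, diagMatrix, pairCoord]
  · have h : ((√(N : ℝ))⁻¹ : ℂ) * ((√(N : ℝ))⁻¹ : ℂ) = (N : ℂ)⁻¹ := by
      rw [← mul_inv, ← Complex.ofReal_mul, Real.mul_self_sqrt (by positivity),
        Complex.ofReal_natCast]
    simp [hadamardFrame, diagMatrix, pairCoord, conjBy, constMatrix, Matrix.star_eq_conjTranspose,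
      smul_smul, h]

theorem wordEval_modelPair_apply (hXs : ∀ i, MemLp (Xs i) ∞ P) (hYs : ∀ i, MemLp (Ys i) ∞ P)
    {N : ℕ} (hN : 0 < N) {H : Matrix (Fin N) (Fin N) ℂ} (hH : H.IsHadamard)
    (L : List (Fin 2 × Polynomial ℂ)) (ω : Ω) :
    (wordEval (![diagMatrix N hXs, conjBy H (diagMatrix N hYs)] : Fin 2 → RandomMatrix P N) L).1 ω =
      (L.map fun p => (hadamardFrame hN hH p.1 : Matrix (Fin N) (Fin N) ℂ) *
        Matrix.diagonal (fun i : Fin N => p.2.eval (pairCoord p.1 (Xs i ω, Ys i ω) : ℂ)) *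
        star (hadamardFrame hN hH p.1 : Matrix (Fin N) (Fin N) ℂ)).prod := by
  rw [wordEval_apply, wordEval]
  simp only [modelPair_apply hXs hYs hN hH, aeval_unitary_conj_diagonal]

theorem memLp_pairCoord (hX : MemLp X ∞ P₀) (hY : MemLp Y ∞ P₀) (k : Fin 2) :
    MemLp (fun ω => pairCoord k (X ω, Y ω)) ∞ P₀ := by
  fin_cases k
  · exact hX
  · exact hY

variable [IsProbabilityMeasure P₀]

/-- The means of polynomials in `X` and of polynomials in `Y`. -/
noncomputable def pairMean (hX : MemLp X ∞ P₀) (hY : MemLp Y ∞ P₀) (k : Fin 2) :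
    Polynomial ℂ →ₗ[ℂ] ℂ :=
  evalMean (memLp_pairCoord hX hY k)

theorem pairMean_one (hX : MemLp X ∞ P₀) (hY : MemLp Y ∞ P₀) (k : Fin 2) :
    pairMean hX hY k 1 = 1 := by
  simp [pairMean, evalMean_apply]

theorem IsIIDCopies.integral_eval (h : IsIIDCopies P₀ X Y P Xs Ys) (hX : MemLp X ∞ P₀)
    (hY : MemLp Y ∞ P₀) (k : Fin 2) (p : Polynomial ℂ) (i : ℕ) :
    ∫ ω, p.eval (pairCoord k (Xs i ω, Ys i ω) : ℂ) ∂P = pairMean hX hY k p := by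
  rw [pairMean, evalMean_apply]
  have := ((h.identDistrib i).comp (u := fun z => p.eval (pairCoord k z : ℂ))
    (p.continuous.measurable.comp (Complex.measurable_ofReal.comp
      (measurable_pairCoord k)))).integral_eq
  simpa [Function.comp_def] using this

variable [IsProbabilityMeasure P]

theorem expectedTrace_aeval_modelPair (h : IsIIDCopies P₀ X Y P Xs Ys) (hX : MemLp X ∞ P₀)
    (hY : MemLp Y ∞ P₀) {N : ℕ} (hN : 0 < N) {H : Matrix (Fin N) (Fin N) ℂ} (hH : H.IsHadamard)
    (k : Fin 2) (p : Polynomial ℂ) :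
    expectedTrace P N (wordEval
      ![diagMatrix N (h.memLp_fst hX), conjBy H (diagMatrix N (h.memLp_snd hY))] [(k, p)]) =
      pairMean hX hY k p := by
  have hN' : (N : ℂ) ≠ 0 := by exact_mod_cast hN.ne'
  simp only [expectedTrace, LinearMap.coe_mk, AddHom.coe_mk, wordEval_modelPair_apply _ _ hN hH,
    List.map_cons, List.map_nil, List.prod_singleton, trace_unitary_conj, Matrix.trace_diagonal]
  rw [integral_finsetSum (f := fun (i : Fin N) ω => p.eval (pairCoord k (Xs i ω, Ys i ω) : ℂ)) _
    fun i _ => integrable_eval (memLp_pairCoord (h.memLp_fst hX i) (h.memLp_snd hY i) k) p]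
  simp [h.integral_eval hX hY, hN']

/-- `K` depends on neither `N` nor the Hadamard matrix: the unnormalized trace is bounded uniformly.
-/
theorem exists_norm_expectedTrace_le_of_even (h : IsIIDCopies P₀ X Y P Xs Ys)
    (hX : MemLp X ∞ P₀) (hY : MemLp Y ∞ P₀) {L : List (Fin 2 × Polynomial ℂ)}
    (hL : IsCenteredWord (pairMean hX hY) L) {m : ℕ} (hm : m ≠ 0) (hlen : L.length = 2 * m) :
    ∃ K : ℝ, ∀ {N : ℕ}, 0 < N → ∀ {H : Matrix (Fin N) (Fin N) ℂ}, H.IsHadamard →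
      ‖expectedTrace P N (wordEval
        ![diagMatrix N (h.memLp_fst hX), conjBy H (diagMatrix N (h.memLp_snd hY))] L)‖ ≤
        (N : ℝ)⁻¹ * K := by
  have hpos : 0 < L.length := by omega
  -- The alternating indices are continued past the end of the word, so that position `2 * m`
  -- returns to the initial index and closes the cycle.
  set idx : ℕ → Fin 2 := fun q => L[0].1 + q • (1 : Fin 2) with hidx
  have hidx_ne : ∀ q, idx q ≠ idx (q + 1) := by
    intro q
    have key : ∀ x y : Fin 2, x + y ≠ x + (y + 1) := by decide
    simpa only [hidx, succ_nsmul] using key L[0].1 (q • (1 : Fin 2))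
  have hidx_end : idx (2 * m) = idx 0 := by
    simp only [hidx, two_mul_nsmul_one_fin_two, zero_nsmul]
  set p : Fin (2 * m) → Polynomial ℂ := fun q => (L[(q : ℕ)]'(by omega)).2 with hp
  have hLfn : L = List.ofFn fun q : Fin (2 * m) => (idx q, p q) := by
    refine List.ext_getElem (by simp [hlen]) fun q h1 h2 => ?_
    rw [List.getElem_ofFn]
    exact Prod.ext (hL.getElem_fst hpos q h1) rfl
  set ν := P₀.map fun ω => (X ω, Y ω) with hν
  have hXY : AEMeasurable (fun ω => (X ω, Y ω)) P₀ :=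
    hX.1.aemeasurable.prodMk hY.1.aemeasurable
  set g : Fin (2 * m) → ℝ × ℝ → ℂ := fun q z => (p q).eval (pairCoord (idx q) z : ℂ) with hgdef
  have hg : ∀ q, Measurable (g q) := fun q =>
    (p q).continuous.measurable.comp (Complex.measurable_ofReal.comp (measurable_pairCoord _))
  have hB : ∃ B, ∀ q, ∀ᵐ z ∂ν, ‖g q z‖ ≤ B := by
    choose B hB using fun q : Fin (2 * m) =>
      exists_ae_norm_eval_le (memLp_pairCoord hX hY (idx q)) (p q)
    refine ⟨∑ q, |B q|, fun q => ?_⟩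
    refine (ae_map_iff hXY (measurableSet_le (hg q).norm measurable_const)).2 ?_
    filter_upwards [hB q] with ω hω
    exact hω.trans ((le_abs_self _).trans
      (Finset.single_le_sum (f := fun q => |B q|) (fun _ _ => abs_nonneg _) (Finset.mem_univ q)))
  obtain ⟨B, hB⟩ := hB
  have h0 : ∀ q, ∫ z, g q z ∂ν = 0 := by
    intro q
    rw [hν, integral_map hXY (hg q).aestronglyMeasurable]
    have hmem : (idx q, p q) ∈ L := by
      rw [hLfn]
      exact List.mem_ofFn.2 ⟨q, rfl⟩
    exact hL.2 _ hmem
  refine ⟨m ^ (2 * m) * B ^ (2 * m), fun {N} hN {H} hH => ?_⟩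
  set U := hadamardFrame hN hH with hU
  have key := norm_integral_trace_le h.indep (fun i => (h.identDistrib i).aemeasurable_fst)
    (fun i => (h.identDistrib i).map_eq) hm hg hB h0 hN
    (fun q => star (U (idx q) : Matrix (Fin N) (Fin N) ℂ) *
      (U (idx (q + 1)) : Matrix (Fin N) (Fin N) ℂ))
    fun q i j => norm_hadamardFrame_le hN hH (hidx_ne q) i j
  simp only [expectedTrace, LinearMap.coe_mk, AddHom.coe_mk, norm_mul, norm_inv,
    Complex.norm_natCast]
  refine mul_le_mul_of_nonneg_left (le_of_eq_of_le (congrArg _ ?_) key) (by positivity)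
  congr 1
  funext ω
  rw [wordEval_modelPair_apply _ _ hN hH, hLfn, List.map_ofFn, ← hU]
  have tel := List.prod_ofFn_mul_telescope
    (fun q => (U (idx q) : Matrix (Fin N) (Fin N) ℂ))
    (fun q => star (U (idx q) : Matrix (Fin N) (Fin N) ℂ))
    (fun q : Fin (2 * m) => Matrix.diagonal fun i : Fin N => g q (Xs i ω, Ys i ω))
  simp only [hidx_end] at tel
  exact trace_eq_of_mul_unitary_eq (U (idx 0)) tel

theorem tendsto_expectedTrace_centeredWord (h : IsIIDCopies P₀ X Y P Xs Ys)
    (hX : MemLp X ∞ P₀) (hY : MemLp Y ∞ P₀) {H : ∀ N : ℕ, Matrix (Fin N) (Fin N) ℂ}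
    (hH : ∀ N : ℕ, 0 < N → (H N).IsHadamard) (L : List (Fin 2 × Polynomial ℂ)) (hne : L ≠ [])
    (hL : IsCenteredWord (pairMean hX hY) L) :
    Tendsto (fun N => expectedTrace P N (wordEval
      ![diagMatrix N (h.memLp_fst hX), conjBy (H N) (diagMatrix N (h.memLp_snd hY))] L))
      atTop (𝓝 0) := by
  obtain ⟨n, hn⟩ : ∃ n, L.length = n := ⟨_, rfl⟩
  induction n using Nat.strong_induction_on generalizing L with
  | _ n ih =>
  have hpos : 0 < L.length := List.length_pos_iff.2 hne
  have even : ∀ L, IsCenteredWord (pairMean hX hY) L → ∀ m ≠ 0, L.length = 2 * m →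
      Tendsto (fun N => expectedTrace P N (wordEval
        ![diagMatrix N (h.memLp_fst hX), conjBy (H N) (diagMatrix N (h.memLp_snd hY))] L))
        atTop (𝓝 0) := by
    intro L hL m hm hlen
    obtain ⟨K, hK⟩ := exists_norm_expectedTrace_le_of_even h hX hY hL hm hlen
    refine squeeze_zero_norm' (a := fun N : ℕ => (N : ℝ)⁻¹ * K) ?_ ?_
    · filter_upwards [eventually_gt_atTop 0] with N hN
      exact hK hN (hH N hN)
    · simpa using (tendsto_natCast_atTop_atTop (R := ℝ)).inv_tendsto_atTop.mul_const K
  obtain ⟨m, hm | hm⟩ := Nat.even_or_odd' L.length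
  · exact even L hL m (by omega) hm
  match L, hne with
  | [(k, p)], _ =>
    have hp : pairMean hX hY k p = 0 := hL.2 (k, p) (by simp)
    refine tendsto_const_nhds.congr' ?_
    filter_upwards [eventually_gt_atTop 0] with N hN
    rw [expectedTrace_aeval_modelPair h hX hY hN (hH N hN), hp]
  | x :: z :: L, _ =>
    obtain ⟨M, y, hM⟩ : ∃ M y, z :: L = M ++ [y] :=
      ⟨_, _, (List.dropLast_append_getLast (List.cons_ne_nil z L)).symm⟩
    rw [hM] at hL hm hn hpos
    have hMlen : M.length + 1 = 2 * m := by simpa using hm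
    have hMne : M ≠ [] := by
      rintro rfl
      simp at hMlen
      omega
    -- Odd length makes the alternation end at the index where it began.
    have hends : y.1 = x.1 := by
      have h1 := hL.getElem_fst hpos (M.length + 1) (by simp)
      have h2 := two_mul_nsmul_one_fin_two m
      rw [← hMlen] at h2
      rw [h2] at h1
      simpa using h1
    have hxM : IsCenteredWord (pairMean hX hY) (x :: M) :=
      ⟨List.IsChain.left_of_append (l₂ := [y]) (by simpa using hL.1),
        fun q hq => hL.2 q (by simp only [List.mem_cons, List.mem_append] at hq ⊢; tauto)⟩
    obtain ⟨hhead, -, hMc⟩ := isCenteredWord_cons.1 hxM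
    -- Cyclicity puts `y` in front of `x`. Splitting `r` into `r - c` and `c` yields an even
    -- centered word and `c` times the shorter word `M`.
    set r := y.2 * x.2 with hr
    set c := pairMean hX hY x.1 r with hc
    have hrM : IsCenteredWord (pairMean hX hY) ((x.1, r - Polynomial.C c) :: M) :=
      isCenteredWord_cons.2 ⟨hhead, apply_sub_C (pairMean_one hX hY) x.1 r, hMc⟩
    have t1 := even _ hrM m (by omega) (by simpa using hMlen)
    have t2 := ih M.length (by rw [← hn]; simp) M hMne hMc rfl
    have t3 := t1.add (t2.const_mul c)
    simp only [mul_zero, add_zero] at t3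
    refine t3.congr fun N => ?_
    rw [hM, ← List.cons_append, wordEval_append, expectedTrace_mul_comm]
    simp only [wordEval_cons, wordEval_nil, mul_one, hends, ← mul_assoc]
    rw [← map_mul, ← hr, map_sub, sub_mul, map_sub, Polynomial.aeval_C, ← Algebra.smul_def,
      map_smul, smul_eq_mul, sub_add_cancel]

end Model

/-! ### The moment problem on a compact interval -/

/-- A normalized functional on real polynomials that is nonnegative on the polynomials that are
nonnegative on `[-C, C]` is integration against a probability measure on `[-C, C]`. -/
theorem exists_measure_of_nonneg_on_Icc {C : ℝ} (hC : 0 < C) (Λ : Polynomial ℝ →ₗ[ℝ] ℝ)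
    (h1 : Λ 1 = 1)
    (hΛ : ∀ p : Polynomial ℝ, (∀ x ∈ Set.Icc (-C) C, 0 ≤ p.eval x) → 0 ≤ Λ p) :
    ∃ ρ : Measure ℝ, IsProbabilityMeasure ρ ∧ ρ (Set.Icc (-C) C)ᶜ = 0 ∧
      ∀ k : ℕ, ∫ x, x ^ k ∂ρ = Λ (Polynomial.X ^ k) := by
  set K := Set.Icc (-C) C with hK
  set T : Polynomial ℝ →ₗ[ℝ] C(K, ℝ) := (Polynomial.toContinuousMapOnAlgHom K).toLinearMap with hT
  have hTapp : ∀ p (x : K), T p x = p.eval (x : ℝ) := fun p x => rfl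
  -- Since `C > 0` the interval is infinite, so restricting polynomials to it loses nothing and `Λ`
  -- lives on a subspace of `C(K, ℝ)`.
  have hinj : Function.Injective T := by
    intro p q hpq
    refine Polynomial.eq_of_infinite_eval_eq p q
      ((Set.Icc_infinite (by linarith : -C < C)).mono fun x hx => ?_)
    have := congrArg (fun f : C(K, ℝ) => f ⟨x, hx⟩) hpq
    simpa [hTapp] using this
  set e := LinearEquiv.ofInjective T hinj with he
  have hdom : ∀ y : LinearMap.range T, T (e.symm y) = y := fun y =>
    congrArg Subtype.val (e.apply_symm_apply y)
  -- Constants are polynomials and dominate every continuous function on `K`, which is the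
  -- cofinality that the extension requires.
  obtain ⟨g, hg, hpos⟩ := riesz_extension (PointedCone.positive ℝ C(K, ℝ))
    ⟨LinearMap.range T, Λ ∘ₗ e.symm.toLinearMap⟩
    (by
      intro y hy
      rw [PointedCone.mem_positive] at hy
      refine hΛ _ fun x hx => ?_
      have h := hy ⟨x, hx⟩
      have h2 := hTapp (e.symm y) ⟨x, hx⟩
      rw [hdom y] at h2
      exact h.trans_eq h2)
    (by
      intro y
      refine ⟨⟨T (Polynomial.C ‖y‖), ⟨_, rfl⟩⟩, ?_⟩
      rw [PointedCone.mem_positive]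
      intro x
      have := (abs_le.1 (y.norm_coe_le_norm x)).1
      change 0 ≤ T (Polynomial.C ‖y‖) x + y x
      rw [hTapp, Polynomial.eval_C]
      linarith)
  have hgT : ∀ p, g (T p) = Λ p := by
    intro p
    rw [hg ⟨T p, ⟨p, rfl⟩⟩]
    exact congrArg Λ (e.symm_apply_apply p)
  set Λ' : CompactlySupportedContinuousMap K ℝ →ₚ[ℝ] ℝ := PositiveLinearMap.mk₀
    { toFun := fun f => g f.toContinuousMap
      map_add' := fun f f' => g.map_add f.toContinuousMap f'.toContinuousMap
      map_smul' := fun r f => g.map_smul r f.toContinuousMap }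
    (fun f hf => hpos _ ((PointedCone.mem_positive ℝ C(K, ℝ)).2 fun x => hf x)) with hΛ'
  set ρ := RealRMK.rieszMeasure Λ' with hρ
  have hint : ∀ p : Polynomial ℝ, ∫ x : K, p.eval (x : ℝ) ∂ρ = Λ p := fun p =>
    (RealRMK.integral_rieszMeasure Λ'
      (CompactlySupportedContinuousMap.continuousMapEquiv (T p))).trans (hgT p)
  have hprob : IsProbabilityMeasure ρ := by
    have := hint 1
    rw [h1] at this
    simp only [Polynomial.eval_one, integral_const, smul_eq_mul, mul_one, measureReal_def] at this
    exact ⟨(ENNReal.toReal_eq_one_iff _).1 this⟩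
  refine ⟨ρ.map Subtype.val, Measure.isProbabilityMeasure_map measurable_subtype_coe.aemeasurable,
    ?_, fun k => ?_⟩
  · rw [Measure.map_apply measurable_subtype_coe measurableSet_Icc.compl]
    convert measure_empty (μ := ρ)
    ext x
    simp
  · rw [integral_map measurable_subtype_coe.aemeasurable (by fun_prop), ← hint]
    simp

/-! ### Positivity and limiting moments -/

section Positivity

open scoped ComplexOrder

/-- The Hermitian matrix `A` has its spectrum in `[-C, C]`. -/
def Matrix.IsBoundedBy {N : ℕ} (A : Matrix (Fin N) (Fin N) ℂ) (C : ℝ) : Prop :=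
  ((C : ℂ) • (1 : Matrix (Fin N) (Fin N) ℂ) - A).PosSemidef ∧
    ((C : ℂ) • (1 : Matrix (Fin N) (Fin N) ℂ) + A).PosSemidef

theorem Matrix.IsBoundedBy.trace_aeval_nonneg {N : ℕ} {A : Matrix (Fin N) (Fin N) ℂ} {C : ℝ}
    (h : A.IsBoundedBy C) {p : Polynomial ℝ} (hp : ∀ x ∈ Set.Icc (-C) C, 0 ≤ p.eval x) :
    0 ≤ (Polynomial.aeval A (p.map (algebraMap ℝ ℂ))).trace := by
  have hA : A.IsHermitian := by
    have := ((Matrix.isHermitian_one (n := Fin N) (α := ℂ)).smul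
      (Complex.conj_ofReal C : IsSelfAdjoint (C : ℂ))).sub h.1.1
    simpa using this
  set u := hA.eigenvectorUnitary
  set d := hA.eigenvalues with hd
  have hspec : A = (u : Matrix (Fin N) (Fin N) ℂ) * Matrix.diagonal (fun i => (d i : ℂ)) *
      star (u : Matrix _ _ ℂ) := hA.spectral_theorem
  have huu : star (u : Matrix (Fin N) (Fin N) ℂ) * (u : Matrix (Fin N) (Fin N) ℂ) = 1 :=
    Unitary.star_mul_self_of_mem u.2
  have hconj : star (u : Matrix (Fin N) (Fin N) ℂ) * A * (u : Matrix (Fin N) (Fin N) ℂ) =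
      Matrix.diagonal (fun i => (d i : ℂ)) := by
    rw [hspec, ← mul_assoc, ← mul_assoc, huu, one_mul, mul_assoc, huu, mul_one]
  -- In an eigenbasis the diagonal entries of the two semidefinite matrices are `C - d i` and `C + d
  -- i`.
  have hbd : ∀ i, d i ∈ Set.Icc (-C) C := by
    intro i
    have h1 := (h.1.conjTranspose_mul_mul_same (u : Matrix (Fin N) (Fin N) ℂ)).diag_nonneg (i := i)
    have h2 := (h.2.conjTranspose_mul_mul_same (u : Matrix (Fin N) (Fin N) ℂ)).diag_nonneg (i := i)
    rw [← Matrix.star_eq_conjTranspose] at h1 h2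
    simp only [mul_sub, sub_mul, mul_add, add_mul, hconj, mul_smul_comm, smul_mul_assoc, mul_one,
      huu] at h1 h2
    simp only [Matrix.sub_apply, Matrix.add_apply, Matrix.smul_apply, Matrix.one_apply_eq,
      Matrix.diagonal_apply_eq, smul_eq_mul, mul_one] at h1 h2
    norm_cast at h1 h2
    exact ⟨by linarith, by linarith⟩
  rw [hspec, aeval_unitary_conj_diagonal, trace_unitary_conj, Matrix.trace_diagonal]
  refine Finset.sum_nonneg fun i _ => ?_
  have : (p.map (algebraMap ℝ ℂ)).eval (d i : ℂ) = ((p.eval (d i) : ℝ) : ℂ) := by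
    simpa using Polynomial.eval_map_apply (algebraMap ℝ ℂ) (d i) (p := p)
  rw [this]
  exact_mod_cast hp _ (hbd i)

theorem expectedTrace_aeval_nonneg {Ω : Type*} [MeasurableSpace Ω] {P : Measure Ω}
    [IsProbabilityMeasure P] {N : ℕ} {A : RandomMatrix P N} {C : ℝ}
    (hA : ∀ᵐ ω ∂P, (A.1 ω).IsBoundedBy C) {p : Polynomial ℝ}
    (hp : ∀ x ∈ Set.Icc (-C) C, 0 ≤ p.eval x) :
    0 ≤ expectedTrace P N (Polynomial.aeval A (p.map (algebraMap ℝ ℂ))) := by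
  have happ : ∀ ω, (Polynomial.aeval A (p.map (algebraMap ℝ ℂ))).1 ω =
      Polynomial.aeval (A.1 ω) (p.map (algebraMap ℝ ℂ)) := fun ω =>
    (Polynomial.aeval_algHom_apply ((Pi.evalAlgHom ℂ
      (fun _ : Ω => Matrix (Fin N) (Fin N) ℂ) ω).comp (RandomMatrix P N).val) A _).symm
  refine mul_nonneg (by simp) (integral_nonneg_of_ae ?_)
  filter_upwards [hA] with ω hω
  rw [happ]
  exact hω.trace_aeval_nonneg hp

/-- If the moments of uniformly bounded Hermitian random matrices converge, then the limits are the
moments of a compactly supported probability measure. -/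
theorem exists_measure_of_tendsto_moments {Ω : Type*} [MeasurableSpace Ω] {P : Measure Ω}
    [IsProbabilityMeasure P] {A : ∀ N, RandomMatrix P N} {C : ℝ} (hC : 0 < C)
    (hA : ∀ᶠ N in atTop, ∀ᵐ ω ∂P, ((A N).1 ω).IsBoundedBy C) {R : Type*} [Ring R] [Algebra ℂ R]
    {μ : R →ₗ[ℂ] ℂ} (h1 : μ 1 = 1) {a : R}
    (hlim : ∀ k : ℕ, Tendsto (fun N => expectedTrace P N (A N ^ k)) atTop (𝓝 (μ (a ^ k)))) :
    ∃ ρ : Measure ℝ, IsProbabilityMeasure ρ ∧ ρ (Set.Icc (-C) C)ᶜ = 0 ∧ HasMomentsOf μ a ρ := by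
  have hpoly : ∀ p : Polynomial ℂ, Tendsto (fun N => expectedTrace P N (Polynomial.aeval (A N) p))
      atTop (𝓝 (μ (Polynomial.aeval a p))) := by
    intro p
    induction p using Polynomial.induction_on' with
    | add p q hp hq => simpa using hp.add hq
    | monomial n r =>
      simpa [Polynomial.aeval_monomial, ← Algebra.smul_def] using (hlim n).const_mul r
  have hnonneg : ∀ p : Polynomial ℝ, (∀ x ∈ Set.Icc (-C) C, 0 ≤ p.eval x) →
      0 ≤ μ (Polynomial.aeval a (p.map (algebraMap ℝ ℂ))) := fun p hp =>
    ge_of_tendsto (hpoly _) (hA.mono fun N hN => expectedTrace_aeval_nonneg hN hp)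
  set Λ : Polynomial ℝ →ₗ[ℝ] ℝ :=
    { toFun := fun p => (μ (Polynomial.aeval a (p.map (algebraMap ℝ ℂ)))).re
      map_add' := fun p q => by simp
      map_smul' := fun r p => by
        rw [Polynomial.smul_eq_C_mul, Polynomial.map_mul, Polynomial.map_C,
          ← Polynomial.smul_eq_C_mul, map_smul, map_smul]
        simp } with hΛ
  obtain ⟨ρ, hρ, hsupp, hmom⟩ := exists_measure_of_nonneg_on_Icc hC Λ (by simp [hΛ, h1])
    fun p hp => (Complex.nonneg_iff.1 (hnonneg p hp)).1
  refine ⟨ρ, hρ, hsupp, fun k => ?_⟩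
  rw [hmom k]
  -- `Λ` retains only real parts. Since `x ^ k + C ^ k` is nonnegative on the interval, its image
  -- under `μ` is real, and so is the moment.
  have him : (μ (a ^ k)).im = 0 := by
    have h := hnonneg (Polynomial.X ^ k + Polynomial.C (C ^ k)) fun x hx => by
      have : |x ^ k| ≤ C ^ k := by
        rw [abs_pow]
        exact pow_le_pow_left₀ (abs_nonneg x) (abs_le.2 hx) k
      have := (abs_le.1 this).1
      simp only [Polynomial.eval_add, Polynomial.eval_pow, Polynomial.eval_X, Polynomial.eval_C]
      linarith
    have h2 := (Complex.nonneg_iff.1 h).2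
    have hμ : ∀ z : ℂ, μ (algebraMap ℂ R z) = z := fun z => by
      rw [Algebra.algebraMap_eq_smul_one, map_smul, h1, smul_eq_mul, mul_one]
    rw [Polynomial.map_add, Polynomial.map_pow, Polynomial.map_X, Polynomial.map_C, map_add,
      Polynomial.aeval_C, map_add, hμ, Complex.add_im] at h2
    simpa only [map_pow, Polynomial.aeval_X, Complex.coe_algebraMap, ← Complex.ofReal_pow,
      Complex.ofReal_im, add_zero] using h2.symm
  apply Complex.ext
  · simp [hΛ]
  · simp [him]

end Positivity

theorem Matrix.trace_mul_pow_comm {n R : Type*} [Fintype n] [DecidableEq n] [CommRing R]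
    (A B : Matrix n n R) (k : ℕ) : ((A * B) ^ k).trace = ((B * A) ^ k).trace := by
  cases k with
  | zero => simp
  | succ k =>
    have h : A * (B * A) ^ k = (A * B) ^ k * A :=
      SemiconjBy.pow_right (show SemiconjBy A (B * A) (A * B) from (mul_assoc A B A).symm) k
    rw [pow_succ, ← mul_assoc, ← h, mul_assoc, Matrix.trace_mul_comm, mul_assoc, ← pow_succ]

/-! ### Spectral bounds for Hermitian matrices -/

section Bounds

open scoped ComplexOrder

variable {N : ℕ}

theorem smul_one_eq_diagonal (C : ℝ) : (C : ℂ) • (1 : Matrix (Fin N) (Fin N) ℂ) =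
    Matrix.diagonal fun _ => (C : ℂ) := by
  rw [← Matrix.diagonal_one, ← Matrix.diagonal_smul]
  congr
  ext
  simp

theorem Matrix.isBoundedBy_diagonal {d : Fin N → ℝ} {C : ℝ} (hd : ∀ i, |d i| ≤ C) :
    (Matrix.diagonal fun i => (d i : ℂ)).IsBoundedBy C := by
  rw [Matrix.IsBoundedBy, smul_one_eq_diagonal, Matrix.diagonal_sub, Matrix.diagonal_add,
    Matrix.posSemidef_diagonal_iff, Matrix.posSemidef_diagonal_iff]
  constructor <;> intro i <;> have := abs_le.1 (hd i) <;> norm_cast <;> linarith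

theorem Matrix.IsBoundedBy.unitary_conj {A : Matrix (Fin N) (Fin N) ℂ} {C : ℝ}
    (hA : A.IsBoundedBy C) (u : unitary (Matrix (Fin N) (Fin N) ℂ)) :
    ((u : Matrix (Fin N) (Fin N) ℂ) * A * star (u : Matrix _ _ ℂ)).IsBoundedBy C := by
  have h1 := hA.1.mul_mul_conjTranspose_same (u : Matrix (Fin N) (Fin N) ℂ)
  have h2 := hA.2.mul_mul_conjTranspose_same (u : Matrix (Fin N) (Fin N) ℂ)
  rw [← Matrix.star_eq_conjTranspose] at h1 h2
  simp only [mul_sub, sub_mul, mul_add, add_mul, mul_smul_comm, smul_mul_assoc, mul_one,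
    Unitary.mul_star_self_of_mem u.2] at h1 h2
  exact ⟨h1, h2⟩

theorem Matrix.IsBoundedBy.add {A B : Matrix (Fin N) (Fin N) ℂ} {C D : ℝ} (hA : A.IsBoundedBy C)
    (hB : B.IsBoundedBy D) : (A + B).IsBoundedBy (C + D) := by
  constructor
  · convert hA.1.add hB.1 using 1
    push_cast
    rw [add_smul]
    abel
  · convert hA.2.add hB.2 using 1
    push_cast
    rw [add_smul]
    abel

/-- With `S` the diagonal matrix, `C * D ∓ S * A * S` is the sum of `C * D - C * S * S` and `S * (C
∓ A) * S`, both positive semidefinite. -/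
theorem Matrix.IsBoundedBy.diagonal_mul_mul_diagonal {A : Matrix (Fin N) (Fin N) ℂ} {C D : ℝ}
    (hA : A.IsBoundedBy C) (hC : 0 ≤ C) {d : Fin N → ℝ} (hd : ∀ i, d i ^ 2 ≤ D) :
    ((Matrix.diagonal fun i => (d i : ℂ)) * A * Matrix.diagonal fun i => (d i : ℂ)).IsBoundedBy
      (C * D) := by
  set S := Matrix.diagonal fun i => (d i : ℂ) with hS
  have hSS : S.conjTranspose = S := by
    rw [hS, Matrix.diagonal_conjTranspose]
    congr
    ext i
    simp
  have h1 := hA.1.mul_mul_conjTranspose_same S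
  have h2 := hA.2.mul_mul_conjTranspose_same S
  have h3 : (((C * D : ℝ) : ℂ) • (1 : Matrix (Fin N) (Fin N) ℂ) -
      (C : ℂ) • (S * S)).PosSemidef := by
    rw [hS, Matrix.diagonal_mul_diagonal, ← Matrix.diagonal_smul, smul_one_eq_diagonal,
      Matrix.diagonal_sub, Matrix.posSemidef_diagonal_iff]
    intro i
    have := mul_le_mul_of_nonneg_left (hd i) hC
    simp only [Pi.smul_apply, smul_eq_mul]
    norm_cast
    nlinarith
  rw [hSS] at h1 h2
  simp only [mul_sub, sub_mul, mul_add, add_mul, mul_smul_comm, smul_mul_assoc, mul_one] at h1 h2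
  constructor
  · convert h3.add h1 using 1
    abel
  · convert h3.add h2 using 1
    abel

end Bounds

/-! ### Free polynomial laws as limits -/

section FreePolynomialLaw

variable {Ω₀ Ω : Type*} [MeasurableSpace Ω₀] [MeasurableSpace Ω] {P₀ : Measure Ω₀} {P : Measure Ω}
  {X Y : Ω₀ → ℝ} {Xs Ys : ℕ → Ω → ℝ} [IsProbabilityMeasure P₀]

/-- The laws of the two members of a pair of random variables. -/
noncomputable def pairLaw (P₀ : Measure Ω₀) (X Y : Ω₀ → ℝ) (k : Fin 2) : Measure ℝ :=
  P₀.map fun ω => pairCoord k (X ω, Y ω)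

theorem pairMean_X_pow (hX : MemLp X ∞ P₀) (hY : MemLp Y ∞ P₀) (k : Fin 2) (n : ℕ) :
    pairMean hX hY k (Polynomial.X ^ n) = ((∫ x, x ^ n ∂(pairLaw P₀ X Y k) : ℝ) : ℂ) := by
  rw [pairMean, evalMean_apply, pairLaw,
    integral_map (memLp_pairCoord hX hY k).1.aemeasurable (by fun_prop)]
  simp only [Polynomial.eval_pow, Polynomial.eval_X, ← Complex.ofReal_pow]
  exact integral_ofReal

theorem HasMomentsOf.apply_aeval (hX : MemLp X ∞ P₀) (hY : MemLp Y ∞ P₀) {k : Fin 2} {A : Type*}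
    [Ring A] [Algebra ℂ A] {τ : A →ₗ[ℂ] ℂ} {a : A} (h : HasMomentsOf τ a (pairLaw P₀ X Y k))
    (p : Polynomial ℂ) : τ (Polynomial.aeval a p) = pairMean hX hY k p := by
  induction p using Polynomial.induction_on' with
  | add p q hp hq => simp [hp, hq]
  | monomial n r =>
    rw [← Polynomial.C_mul_X_pow_eq_monomial, ← Polynomial.smul_eq_C_mul, map_smul, map_smul,
      map_smul, pairMean_X_pow, ← h n]
    simp

theorem IsFreePolynomialLaw.exists_functional (hX : MemLp X ∞ P₀) (hY : MemLp Y ∞ P₀)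
    {p : FreeAlgebra ℂ (Fin 2)} {ρ : Measure ℝ}
    (h : IsFreePolynomialLaw p (P₀.map X) (P₀.map Y) ρ) :
    ∃ τ : FreeAlgebra ℂ (Fin 2) →ₗ[ℂ] ℂ, τ 1 = 1 ∧ HasMomentsOf τ p ρ ∧
      ∀ L ≠ [], IsCenteredWord (pairMean hX hY) L →
        τ (wordEval (FreeAlgebra.ι ℂ) L) = 0 := by
  obtain ⟨τ, h1, hfree, h0, h1', hp⟩ := h.moments
  refine ⟨τ, h1, hp, hfree.apply_centeredWord fun k q => ?_⟩
  have hk : HasMomentsOf τ (FreeAlgebra.ι ℂ k) (pairLaw P₀ X Y k) := by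
    fin_cases k
    · exact h0
    · exact h1'
  exact hk.apply_aeval hX hY q

variable [IsProbabilityMeasure P]

/-- Bounded Hermitian random matrices whose moments are asymptotically those of a polynomial `p` in
two asymptotically free random matrices converge in moments to the free polynomial law of `p`. -/
theorem exists_isFreePolynomialLaw_and_convergesInMoments (hX : MemLp X ∞ P₀) (hY : MemLp Y ∞ P₀)
    {a : ∀ N, Fin 2 → RandomMatrix P N} {μ : FreeAlgebra ℂ (Fin 2) →ₗ[ℂ] ℂ} (hμ1 : μ 1 = 1)
    (hlim : ∀ f, Tendsto (fun N => jointLaw (expectedTrace P N) (a N) f) atTop (𝓝 (μ f)))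
    (hμ : ∀ L ≠ [], IsCenteredWord (pairMean hX hY) L → μ (wordEval (FreeAlgebra.ι ℂ) L) = 0)
    {p : FreeAlgebra ℂ (Fin 2)} {A : ∀ N, RandomMatrix P N} {C : ℝ} (hC : 0 < C)
    (hA : ∀ᶠ N in atTop, ∀ᵐ ω ∂P, ((A N).1 ω).IsBoundedBy C)
    (hAp : ∀ N k, expectedTrace P N (A N ^ k) = jointLaw (expectedTrace P N) (a N) (p ^ k)) :
    (∃ ρ, IsFreePolynomialLaw p (P₀.map X) (P₀.map Y) ρ) ∧
      ∀ ρ, IsFreePolynomialLaw p (P₀.map X) (P₀.map Y) ρ →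
        ConvergesInMoments (expectedTrace P) A ρ := by
  have hmom : ∀ k : ℕ, Tendsto (fun N => expectedTrace P N (A N ^ k)) atTop (𝓝 (μ (p ^ k))) :=
    fun k => (hlim (p ^ k)).congr fun N => (hAp N k).symm
  have hvar : ∀ k, HasMomentsOf μ (FreeAlgebra.ι ℂ k) (pairLaw P₀ X Y k) := by
    intro k n
    rw [← pairMean_X_pow hX hY, ← apply_aeval_of_forall_centeredWord (pairMean_one hX hY) hμ1 hμ]
    simp
  constructor
  · obtain ⟨ρ, hρ, hsupp, hρm⟩ := exists_measure_of_tendsto_moments hC hA hμ1 hmom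
    exact ⟨ρ, hρ, ⟨_, isCompact_Icc, hsupp⟩, μ, hμ1,
      freeFamily_of_forall_centeredWord (pairMean_one hX hY) hμ1 hμ, hvar 0, hvar 1, hρm⟩
  · intro ρ hρ k
    obtain ⟨τ, hτ1, hτp, hτ⟩ := hρ.exists_functional hX hY
    -- Both functionals are normalized and vanish on nonempty centered words, so `τ = μ`.
    rw [← hτp k, ← eq_of_forall_centeredWord (pairMean_one hX hY) hμ1 hτ1 hμ hτ]
    exact hmom k

end FreePolynomialLaw

/-! ### Sums and products in the model -/

section Main

variable {Ω₀ Ω : Type*} [MeasurableSpace Ω₀] [MeasurableSpace Ω] {P₀ : Measure Ω₀} {P : Measure Ω}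
  {X Y : Ω₀ → ℝ} {Xs Ys : ℕ → Ω → ℝ}

theorem IsIIDCopies.exists_bound (h : IsIIDCopies P₀ X Y P Xs Ys) (hX : MemLp X ∞ P₀)
    (hY : MemLp Y ∞ P₀) : ∃ C : ℝ, 0 < C ∧ ∀ᵐ ω ∂P, ∀ i, |Xs i ω| ≤ C ∧ |Ys i ω| ≤ C := by
  obtain ⟨B, hB⟩ := exists_ae_norm_eval_le hX Polynomial.X
  obtain ⟨D, hD⟩ := exists_ae_norm_eval_le hY Polynomial.X
  refine ⟨max (max B D) 1, by positivity, ae_all_iff.2 fun i => ?_⟩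
  refine (h.identDistrib i).symm.ae_snd
    (p := fun z : ℝ × ℝ => |z.1| ≤ max (max B D) 1 ∧ |z.2| ≤ max (max B D) 1) ?_ ?_
  · exact (measurableSet_le measurable_fst.abs measurable_const).inter
      (measurableSet_le measurable_snd.abs measurable_const)
  · filter_upwards [hB, hD] with ω h1 h2
    simp only [Polynomial.eval_X, Complex.norm_real, Real.norm_eq_abs] at h1 h2
    simp [h1, h2]

theorem isBoundedBy_modelPair_snd (hXs : ∀ i, MemLp (Xs i) ∞ P) (hYs : ∀ i, MemLp (Ys i) ∞ P)
    {N : ℕ} (hN : 0 < N) {H : Matrix (Fin N) (Fin N) ℂ} (hH : H.IsHadamard) {C : ℝ} {ω : Ω}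
    (hω : ∀ i, |Ys i ω| ≤ C) : ((conjBy H (diagMatrix N hYs)).1 ω).IsBoundedBy C := by
  have h := modelPair_apply hXs hYs hN hH 1 ω
  simp only [Matrix.cons_val_one, Matrix.cons_val_zero] at h
  rw [h]
  exact (Matrix.isBoundedBy_diagonal fun i => hω i).unitary_conj _

/-- Almost surely the square roots multiply back to the diagonal matrix, and cyclicity moves one of
them across each power. -/
theorem expectedTrace_sqrt_mul_mul_sqrt_pow [IsProbabilityMeasure P]
    (hXs : ∀ i, MemLp (Xs i) ∞ P) (hpos : ∀ i, ∀ᵐ ω ∂P, 0 ≤ Xs i ω) {N : ℕ}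
    (Z : RandomMatrix P N) (k : ℕ) :
    expectedTrace P N ((diagMatrix N (fun i => memLp_top_sqrt (hXs i)) * Z *
      diagMatrix N (fun i => memLp_top_sqrt (hXs i))) ^ k) =
      expectedTrace P N ((diagMatrix N hXs * Z) ^ k) := by
  simp only [expectedTrace, LinearMap.coe_mk, AddHom.coe_mk]
  congr 1
  refine integral_congr_ae ?_
  filter_upwards [ae_all_iff.2 hpos] with ω hω
  set S : Matrix (Fin N) (Fin N) ℂ := Matrix.diagonal fun i => ((Real.sqrt (Xs i ω) : ℝ) : ℂ)
  have hSS : S * S = (diagMatrix N hXs).1 ω := by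
    rw [Matrix.diagonal_mul_diagonal]
    change _ = Matrix.diagonal fun i : Fin N => ((Xs i ω : ℝ) : ℂ)
    congr
    ext i
    rw [← Complex.ofReal_mul, Real.mul_self_sqrt (hω i)]
  change ((S * Z.1 ω * S) ^ k).trace = (((diagMatrix N hXs).1 ω * Z.1 ω) ^ k).trace
  rw [Matrix.trace_mul_pow_comm, ← hSS, mul_assoc]

end Main

/-- Complex Hadamard matrices are Mathlib's `Matrix.IsHadamard` over `ℂ`: entries of modulus `1` and
`H * Hᴴ = Hᴴ * H = N • 1`. Matrices of size `N = 0` play no role: all claims concern the limit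
`N → ∞`. -/
theorem corollary3p3 {Ω₀ Ω : Type*} [MeasurableSpace Ω₀] [MeasurableSpace Ω]
    (P₀ : Measure Ω₀) [IsProbabilityMeasure P₀] (P : Measure Ω) [IsProbabilityMeasure P]
    (X Y : Ω₀ → ℝ) (hX : MemLp X ∞ P₀) (hY : MemLp Y ∞ P₀)
    (Xs Ys : ℕ → Ω → ℝ) (hcopies : IsIIDCopies P₀ X Y P Xs Ys)
    (H : ∀ N : ℕ, Matrix (Fin N) (Fin N) ℂ) (hH : ∀ N : ℕ, 0 < N → (H N).IsHadamard) :
    AsymptoticallyFree (expectedTrace P)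
      (fun N => ![diagMatrix N (hcopies.memLp_fst hX),
        conjBy (H N) (diagMatrix N (hcopies.memLp_snd hY))]) ∧
    (IsFreeAdditiveConvolution (P₀.map X) (P₀.map Y)
        (freeAdditiveConvolution (P₀.map X) (P₀.map Y)) ∧
      ConvergesInMoments (expectedTrace P)
        (fun N => diagMatrix N (hcopies.memLp_fst hX) +
          conjBy (H N) (diagMatrix N (hcopies.memLp_snd hY)))
        (freeAdditiveConvolution (P₀.map X) (P₀.map Y))) ∧
    ((∀ i, ∀ᵐ ω ∂P, 0 ≤ Xs i ω) →
      IsFreeMultiplicativeConvolution (P₀.map X) (P₀.map Y)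
        (freeMultiplicativeConvolution (P₀.map X) (P₀.map Y)) ∧
      ConvergesInMoments (expectedTrace P)
        (fun N => diagMatrix N (fun i => memLp_top_sqrt (hcopies.memLp_fst hX i)) *
          conjBy (H N) (diagMatrix N (hcopies.memLp_snd hY)) *
          diagMatrix N (fun i => memLp_top_sqrt (hcopies.memLp_fst hX i)))
        (freeMultiplicativeConvolution (P₀.map X) (P₀.map Y))) := by
  obtain ⟨μ, hμ1, hlim, hμ⟩ := exists_limit_of_forall_centeredWord
    (φ := expectedTrace P) (pairMean_one hX hY)
    (a := fun N => ![diagMatrix N (hcopies.memLp_fst hX),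
      conjBy (H N) (diagMatrix N (hcopies.memLp_snd hY))])
    -- The identity has expected trace `1` only for `N > 0`.
    (tendsto_const_nhds.congr' (by
      filter_upwards [eventually_gt_atTop 0] with N hN
      exact (expectedTrace_one hN).symm))
    (tendsto_expectedTrace_centeredWord hcopies hX hY hH)
  obtain ⟨C, hC, hbound⟩ := hcopies.exists_bound hX hY
  refine ⟨⟨μ, hμ1, hlim, freeFamily_of_forall_centeredWord (pairMean_one hX hY) hμ1 hμ⟩, ?_,
    fun hpos => ?_⟩
  · obtain ⟨hex, hconv⟩ := exists_isFreePolynomialLaw_and_convergesInMoments hX hY hμ1 hlim hμ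
      (p := FreeAlgebra.ι ℂ 0 + FreeAlgebra.ι ℂ 1)
      (A := fun N => diagMatrix N (hcopies.memLp_fst hX) +
        conjBy (H N) (diagMatrix N (hcopies.memLp_snd hY)))
      (C := C + C) (by positivity)
      (by
        filter_upwards [eventually_gt_atTop 0] with N hN
        filter_upwards [hbound] with ω hω
        exact (Matrix.isBoundedBy_diagonal fun i : Fin N => (hω i).1).add
          (isBoundedBy_modelPair_snd (hcopies.memLp_fst hX) (hcopies.memLp_snd hY) hN (hH N hN)
            fun i => (hω i).2))
      (fun N k => by simp [jointLaw])
    have hfree : IsFreeAdditiveConvolution (P₀.map X) (P₀.map Y)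
        (freeAdditiveConvolution (P₀.map X) (P₀.map Y)) := by
      rw [freeAdditiveConvolution,
        dif_pos (show ∃ ρ, IsFreeAdditiveConvolution (P₀.map X) (P₀.map Y) ρ from hex)]
      exact Exists.choose_spec _
    -- The convolution is an unspecified choice among admissible measures, so convergence is needed
    -- towards each of them.
    exact ⟨hfree, hconv _ hfree⟩
  · obtain ⟨hex, hconv⟩ := exists_isFreePolynomialLaw_and_convergesInMoments hX hY hμ1 hlim hμ
      (p := FreeAlgebra.ι ℂ 0 * FreeAlgebra.ι ℂ 1)
      (A := fun N => diagMatrix N (fun i => memLp_top_sqrt (hcopies.memLp_fst hX i)) *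
        conjBy (H N) (diagMatrix N (hcopies.memLp_snd hY)) *
        diagMatrix N (fun i => memLp_top_sqrt (hcopies.memLp_fst hX i)))
      (C := C * C) (by positivity)
      (by
        filter_upwards [eventually_gt_atTop 0] with N hN
        filter_upwards [hbound, ae_all_iff.2 hpos] with ω hω hω'
        refine (isBoundedBy_modelPair_snd (hcopies.memLp_fst hX) (hcopies.memLp_snd hY) hN
          (hH N hN) fun i => (hω i).2).diagonal_mul_mul_diagonal hC.le
          (d := fun i => Real.sqrt (Xs i ω)) fun i => ?_
        rw [Real.sq_sqrt (hω' i)]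
        exact (le_abs_self _).trans (hω i).1)
      (fun N k => by
        rw [expectedTrace_sqrt_mul_mul_sqrt_pow (hcopies.memLp_fst hX) hpos]
        simp [jointLaw])
    have hfree : IsFreeMultiplicativeConvolution (P₀.map X) (P₀.map Y)
        (freeMultiplicativeConvolution (P₀.map X) (P₀.map Y)) := by
      rw [freeMultiplicativeConvolution,
        dif_pos (show ∃ ρ, IsFreeMultiplicativeConvolution (P₀.map X) (P₀.map Y) ρ from hex)]
      exact Exists.choose_spec _
    exact ⟨hfree, hconv _ hfree⟩
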